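/- Let $R$ be a profinite ring with unity (not necessarily commutative); "module" means right module. For a profinite $R$-module $Z$ and a discrete $R$-module $A$ let $\mathrm{Ext}^n_R(Z,A)$ be the value at $A$ of the $n$-th right derived functor of $\mathrm{Hom}_R(Z,-)$ (continuous homomorphisms) on the abelian category of discrete $R$-modules. An étale space of $R$-modules over a profinite space $X$ is a local homeomorphism $p\colon\mathcal A\to X$ whose fibres $A_x=p^{-1}(x)$ are discrete $R$-modules such that the zero section $X\to\mathcal A$, the addition $\mathcal A\times_X\mathcal A\to\mathcal A$ and the action $\mathcal A\times R\to\mathcal A$ are continuous. A morphism $(\mathcal A,X)\to(\mathcal B,Y)$ is a continuous map $f\colon Y\to X$ with a continuous map $\phi\colon\mathcal A\times_XY\to\mathcal B$ over $Y$ that is given by $R$-homomorphisms $\phi_y\colon A_{f(y)}\to B_y$. The continuous product $\dot\prod\mathcal A$ is the discrete $R$-module of continuous global sections of $\mathcal A$. For $U\subseteq X$ clopen, $\mathcal A(U)$ is the discrete $R$-module of continuous sections over $U$, and $\mathrm{ev}_x\colon\mathcal A(U)\to A_x$ ($x\in U$) is evaluation at $x$. Then the following hold, for every $n\ge 0$,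 profinite $R$-module $Z$, profinite space $X$ and étale space $\mathcal A$ of $R$-modules over $X$. 1. The disjoint union $\bigsqcup_{x\in X}\mathrm{Ext}^n_R(Z,A_x)$, with the topology generated by the sets $\{\mathrm{Ext}^n_R(Z,\mathrm{ev}_x)(s)\mid x\in U\}$ for $U\subseteq X$ clopen and $s\in\mathrm{Ext}^n_R(Z,\mathcal A(U))$, is an étale space over $X$ of discrete torsion abelian groups (equivalently, of discrete $\widehat{\mathbb Z}$-modules). Every morphism $(\phi,f)\colon(\mathcal A,X)\to(\mathcal B,Y)$ induces, through the maps $\mathrm{Ext}^n_R(Z,\phi_y)$, a morphism of these étale spaces. Write $\dot\prod_{x\in X}\mathrm{Ext}^n_R(Z,A_x)$ for the group of continuous global sections. 2. The assignment $a\mapsto\bigl(x\mapsto\mathrm{Ext}^n_R(Z,\mathrm{ev}_x)(a)\bigr)$ is an isomorphism of groups $$\mathrm{Ext}^n_R\bigl(Z,\dot\prod\mathcal A\bigr)\;\cong\;\dot\prod_{x\in X}\mathrm{Ext}^n_R(Z,A_x),$$ natural in $\mathcal A$ (for all morphisms $(\phi,f)$ of étale spaces) and in $Z$. 3. These isomorphisms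 form isomorphisms of cohomological $\delta$-functors. For fixed $X$ and $Z$, both sides are cohomological $\delta$-functors in the étale space $\mathcal A$ over $X$ (a sequence of étale spaces over $X$ is short exact if it is so on every fibre); for fixed $\mathcal A$, both sides are contravariant cohomological $\delta$-functors in $Z$. In both cases, the maps and connecting homomorphisms on the left are the usual ones of $\mathrm{Ext}^\bullet_R$ (in the first case for the short exact sequence of modules of global sections), on the right they are those of $\mathrm{Ext}^\bullet_R$ applied in every fibre, and the isomorphisms of 2. commute with them. -/

import Mathlib

open CategoryTheory Limits MulOpposite Topology

universe u

/-- A right `R`-module (a module over `Rᵐᵒᵖ`) is discrete if the action of `R` is continuous for the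
discrete topology on the module. -/
def IsDiscreteMod (R : Type u) [Ring R] [TopologicalSpace R] :
    ObjectProperty (ModuleCat.{u} Rᵐᵒᵖ) :=
  fun M => letI : TopologicalSpace M := ⊥; ContinuousSMul Rᵐᵒᵖ M

section DMod

variable {R : Type u} [Ring R] [TopologicalSpace R]

lemma IsDiscreteMod.isOpen_ann {M : ModuleCat.{u} Rᵐᵒᵖ} (hM : IsDiscreteMod R M) (m : M) :
    IsOpen {r : Rᵐᵒᵖ | r • m = 0} := by
  let _ : TopologicalSpace M := ⊥
  have : DiscreteTopology M := ⟨rfl⟩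
  have : ContinuousSMul Rᵐᵒᵖ M := hM
  have h : Continuous fun r : Rᵐᵒᵖ => r • m := by fun_prop
  exact (isOpen_discrete ({0} : Set M)).preimage h

variable [IsTopologicalRing R]

lemma IsDiscreteMod.of_isOpen_ann {M : ModuleCat.{u} Rᵐᵒᵖ}
    (h : ∀ m : M, IsOpen {r : Rᵐᵒᵖ | r • m = 0}) : IsDiscreteMod R M := by
  let _ : TopologicalSpace M := ⊥
  have : DiscreteTopology M := ⟨rfl⟩
  refine ⟨?_⟩
  rw [continuous_prod_of_discrete_right]
  intro m
  rw [continuous_discrete_rng]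
  intro b
  rw [isOpen_iff_mem_nhds]
  intro r hr
  have h1 : {s : Rᵐᵒᵖ | s • m = b} = (fun s => s - r) ⁻¹' {s : Rᵐᵒᵖ | s • m = 0} := by
    have hr' : r • m = b := hr
    ext s
    simp [sub_smul, hr', sub_eq_zero]
  change {s : Rᵐᵒᵖ | s • m = b} ∈ nhds r
  rw [h1]
  exact ((h m).preimage (by fun_prop)).mem_nhds (by simp)

instance : (IsDiscreteMod R).IsClosedUnderSubobjects where
  prop_of_mono {M N} f _ hN := by
    refine .of_isOpen_ann fun m => ?_
    have hf : Function.Injective f.hom := (ModuleCat.mono_iff_injective f).1 inferInstance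
    convert hN.isOpen_ann (f.hom m) using 3 with r
    rw [← map_smul, map_eq_zero_iff _ hf]

lemma isOpen_of_le_ann {M : Type u} [AddCommGroup M] [Module Rᵐᵒᵖ M] (m : M) (V : Set Rᵐᵒᵖ)
    (hV : IsOpen V) (h0 : (0 : Rᵐᵒᵖ) ∈ V) (h : ∀ r ∈ V, r • m = 0) :
    IsOpen {r : Rᵐᵒᵖ | r • m = 0} := by
  rw [isOpen_iff_mem_nhds]
  intro r hr
  have h1 : (fun s => s - r) ⁻¹' V ∈ nhds r :=
    (hV.preimage (by fun_prop)).mem_nhds (by simpa using h0)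
  refine Filter.mem_of_superset h1 fun s hs => ?_
  have := h _ hs
  have hr' : r • m = 0 := hr
  simpa [sub_smul, hr'] using this

instance : (IsDiscreteMod R).IsClosedUnderQuotients where
  prop_of_epi {M N} f _ hM := by
    refine .of_isOpen_ann fun n => ?_
    obtain ⟨m, rfl⟩ := (ModuleCat.epi_iff_surjective f).1 inferInstance n
    refine isOpen_of_le_ann _ _ (hM.isOpen_ann m) (by simp) fun r hr => ?_
    have hr' : r • m = 0 := hr
    rw [← map_smul, hr', map_zero]

instance : (IsDiscreteMod R).ContainsZero where
  exists_zero := ⟨ModuleCat.of Rᵐᵒᵖ PUnit, ModuleCat.isZero_of_subsingleton _,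
    .of_isOpen_ann fun m => by
      convert isOpen_univ using 1
      ext r
      simp⟩

instance : (IsDiscreteMod R).IsClosedUnderFiniteProducts where
  isClosedUnderLimitsOfShape J _ := by
    refine ⟨?_⟩
    rintro M ⟨p⟩
    refine .of_isOpen_ann fun m => ?_
    have h : {r : Rᵐᵒᵖ | r • m = 0} =
        ⋂ j : Discrete J, {r : Rᵐᵒᵖ | r • (p.π.app j).hom m = 0} := by
      ext r
      simp only [Set.mem_ofPred_eq, Set.mem_iInter]
      constructor
      · intro hr j
        rw [← map_smul, hr, map_zero]
      · intro hr
        refine Concrete.isLimit_ext _ p.isLimit _ _ fun j => ?_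
        have h1 := hr j
        rw [← map_smul] at h1
        exact h1.trans (map_zero (p.π.app j).hom).symm
    rw [h]
    exact isOpen_iInter_of_finite fun j => (p.prop_diag_obj j).isOpen_ann _

/-- The discrete part of a right `R`-module: the elements with open annihilator. -/
def discretePart (M : Type u) [AddCommGroup M] [Module Rᵐᵒᵖ M] : Submodule Rᵐᵒᵖ M where
  carrier := {m | IsOpen {r : Rᵐᵒᵖ | r • m = 0}}
  zero_mem' := by simp
  add_mem' {a b} ha hb := by
    refine isOpen_of_le_ann _ _ (IsOpen.inter ha hb) (by simp) fun r hr => ?_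
    have h1 : r • a = 0 := hr.1
    have h2 : r • b = 0 := hr.2
    rw [smul_add, h1, h2, add_zero]
  smul_mem' r m hm := by
    have h : {s : Rᵐᵒᵖ | s • r • m = 0} = (fun s => s * r) ⁻¹' {s : Rᵐᵒᵖ | s • m = 0} := by
      ext s
      simp [mul_smul]
    change IsOpen {s : Rᵐᵒᵖ | s • r • m = 0}
    rw [h]
    exact IsOpen.preimage (by fun_prop) hm

variable (R) in
/-- The category of discrete right `R`-modules. -/
abbrev DMod : Type (u + 1) := (IsDiscreteMod R).FullSubcategory

/-- The right `R`-module of elements with open annihilator is discrete. -/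
lemma isDiscreteMod_discretePart (M : Type u) [AddCommGroup M] [Module Rᵐᵒᵖ M] :
    IsDiscreteMod R (ModuleCat.of Rᵐᵒᵖ (discretePart (R := R) M)) := by
  refine .of_isOpen_ann fun m => ?_
  have h : {r : Rᵐᵒᵖ | r • m = 0} = {r : Rᵐᵒᵖ | r • (m : M) = 0} := by
    ext r
    exact Subtype.ext_iff
  rw [h]
  exact m.2

instance : (IsDiscreteMod R).ι.PreservesMonomorphisms :=
  (IsDiscreteMod R).preservesMonomorphisms_ι_of_isNormalEpiCategory

instance : (IsDiscreteMod R).ι.PreservesEpimorphisms :=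
  (IsDiscreteMod R).preservesEpimorphisms_ι_of_isNormalMonoCategory

instance : EnoughInjectives (DMod R) where
  presentation M := by
    let p := (EnoughInjectives.presentation M.obj).some
    let J : DMod R := ⟨ModuleCat.of Rᵐᵒᵖ (discretePart (R := R) p.J), isDiscreteMod_discretePart _⟩
    have key : ∀ (N : DMod R) (f : N.obj ⟶ p.J) (n : N.obj), f.hom n ∈ discretePart (R := R) p.J := by
      intro N f n
      refine isOpen_of_le_ann _ _ (N.property.isOpen_ann n) (by simp) fun r hr => ?_
      have hr' : r • n = 0 := hr
      rw [← map_smul, hr', map_zero]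
    let lift : ∀ (N : DMod R) (f : N.obj ⟶ p.J), N ⟶ J := fun N f =>
      ObjectProperty.homMk (ModuleCat.ofHom (f.hom.codRestrict _ (key N f)))
    let inc : J.obj ⟶ p.J := ModuleCat.ofHom (Submodule.subtype _)
    have hlift : ∀ N f, (lift N f).hom ≫ inc = f := fun N f => rfl
    have hinc : Mono inc := (ModuleCat.mono_iff_injective _).2 Subtype.val_injective
    refine ⟨⟨J, ⟨?_⟩, lift M p.f, ?_⟩⟩
    · intro X Y g f hf
      have hf' : Mono f.hom := inferInstanceAs (Mono ((IsDiscreteMod R).ι.map f))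
      refine ⟨lift Y (Injective.factorThru (g.hom ≫ inc) f.hom), ?_⟩
      ext1
      rw [← cancel_mono inc]
      simp [hlift]
    · have h1 : Mono ((lift M p.f).hom ≫ inc) := by rw [hlift]; infer_instance
      have : Mono ((IsDiscreteMod R).ι.map (lift M p.f)) := @mono_of_mono _ _ _ _ _ _ inc h1
      exact (IsDiscreteMod R).ι.mono_of_mono_map this

end DMod

section PMod

variable (R : Type u) [Ring R] [TopologicalSpace R]

/-- A topological right `R`-module is profinite if its underlying space is compact, Hausdorff and
totally disconnected. -/
def IsProfiniteMod : ObjectProperty (TopModuleCat.{u} Rᵐᵒᵖ) :=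
  fun M => CompactSpace M ∧ T2Space M ∧ TotallyDisconnectedSpace M

/-- The category of profinite right `R`-modules and continuous module homomorphisms. -/
abbrev PMod : Type (u + 1) := (IsProfiniteMod R).FullSubcategory

variable {R}

/-- The group of continuous `R`-module homomorphisms from `Z` to the discrete module `A`
(a map to a discrete space is continuous if and only if it is locally constant). -/
def contHom (Z : PMod R) (A : DMod R) : AddSubgroup (Z.obj →ₗ[Rᵐᵒᵖ] A.obj) where
  carrier := {f | IsLocallyConstant f}
  zero_mem' := IsLocallyConstant.const (0 : A.obj)
  add_mem' hf hg := IsLocallyConstant.add hf hg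
  neg_mem' hf := IsLocallyConstant.neg hf

variable [IsTopologicalRing R]

/-- The functor `A ↦ Hom_R(Z, A)` from discrete modules to abelian groups. -/
def homFunctor (Z : PMod R) : DMod R ⥤ AddCommGrpCat.{u} where
  obj A := AddCommGrpCat.of (contHom Z A)
  map {A B} φ := AddCommGrpCat.ofHom
    { toFun f := ⟨φ.hom.hom ∘ₗ f.1, f.2.comp φ.hom.hom⟩
      map_zero' := by ext; simp
      map_add' f g := by ext; simp }

instance (Z : PMod R) : (homFunctor Z).Additive where
  map_add {A B φ ψ} := by
    ext f
    rfl

/-- The natural transformation `Hom_R(Z, -) ⟶ Hom_R(Z', -)` induced by `Z' ⟶ Z`. -/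
def homPrecomp {Z' Z : PMod R} (ζ : Z' ⟶ Z) : homFunctor Z ⟶ homFunctor Z' where
  app A := AddCommGrpCat.ofHom
    { toFun f := ⟨f.1 ∘ₗ ζ.hom.hom.toLinearMap, f.2.comp_continuous ζ.hom.hom.continuous⟩
      map_zero' := by ext; simp
      map_add' f g := by ext; simp }

/-- `Ext_R^n(Z, -)`: the `n`-th right derived functor of `Hom_R(Z, -)` on discrete modules. -/
noncomputable def extFunctor (Z : PMod R) (n : ℕ) : DMod R ⥤ AddCommGrpCat.{u} :=
  (homFunctor Z).rightDerived n

/-- `Ext_R^n(Z, A)` for `Z` profinite and `A` discrete. -/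
noncomputable abbrev ExtR (Z : PMod R) (A : DMod R) (n : ℕ) : Type u := (extFunctor Z n).obj A

/-- The map `Ext_R^n(Z, A) → Ext_R^n(Z, B)` induced by `φ : A ⟶ B`. -/
noncomputable def extPost (Z : PMod R) {A B : DMod R} (φ : A ⟶ B) (n : ℕ) :
    ExtR Z A n →+ ExtR Z B n :=
  ((extFunctor Z n).map φ).hom

/-- The map `Ext_R^n(Z, A) → Ext_R^n(Z', A)` induced by `ζ : Z' ⟶ Z`. -/
noncomputable def extPre {Z' Z : PMod R} (ζ : Z' ⟶ Z) (A : DMod R) (n : ℕ) :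
    ExtR Z A n →+ ExtR Z' A n :=
  ((NatTrans.rightDerived (homPrecomp ζ) n).app A).hom

end PMod

section Horseshoe

open Preadditive

universe v₁ u₁

variable {C : Type u₁} [Category.{v₁} C] [Abelian C]

/-- A short exact sequence of injective resolutions over a short complex `S`. -/
structure ResolvedSequence (S : ShortComplex C) where
  /-- a resolution of the first object -/
  res₁ : InjectiveResolution S.X₁
  /-- a resolution of the second object -/
  res₂ : InjectiveResolution S.X₂
  /-- a resolution of the third object -/
  res₃ : InjectiveResolution S.X₃
  /-- a chain map lifting `S.f` -/
  f : res₁.cocomplex ⟶ res₂.cocomplex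
  /-- a chain map lifting `S.g` -/
  g : res₂.cocomplex ⟶ res₃.cocomplex
  zero : f ≫ g = 0
  shortExact : (ShortComplex.mk f g zero).ShortExact
  comm_f : res₁.ι ≫ f = (CochainComplex.single₀ C).map S.f ≫ res₂.ι
  comm_g : res₂.ι ≫ g = (CochainComplex.single₀ C).map S.g ≫ res₃.ι

namespace Horseshoe

variable {S : ShortComplex C} (I : InjectiveResolution S.X₁) (J : InjectiveResolution S.X₃)

/-- The augmentation of an injective resolution. -/
noncomputable def aug {X : C} (I : InjectiveResolution X) : X ⟶ I.cocomplex.X 0 := I.ι.f 0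

lemma aug_d {X : C} (I : InjectiveResolution X) : aug I ≫ I.cocomplex.d 0 1 = 0 :=
  I.ι_f_zero_comp_complex_d

instance {X : C} (I : InjectiveResolution X) : Mono (aug I) :=
  inferInstanceAs (Mono (I.ι.f 0))

lemma aug_exact {X : C} (I : InjectiveResolution X) :
    (ShortComplex.mk (aug I) (I.cocomplex.d 0 1) (aug_d I)).Exact := I.exact₀

/-- One step of the recursive construction of the twisting maps. -/
noncomputable def step (n : ℕ) (p : J.cocomplex.X n ⟶ I.cocomplex.X (n + 1))
    (q : {q : J.cocomplex.X (n + 1) ⟶ I.cocomplex.X (n + 2) //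
      J.cocomplex.d n (n + 1) ≫ q = p ≫ I.cocomplex.d (n + 1) (n + 2)}) :
    {r : J.cocomplex.X (n + 2) ⟶ I.cocomplex.X (n + 3) //
      J.cocomplex.d (n + 1) (n + 2) ≫ r = q.1 ≫ I.cocomplex.d (n + 2) (n + 3)} :=
  ⟨(J.exact_succ n).descToInjective (q.1 ≫ I.cocomplex.d (n + 2) (n + 3))
    (by have := q.2; dsimp; rw [reassoc_of% this]; simp),
    (J.exact_succ n).comp_descToInjective _ _⟩

lemma exists_twist (c : S.X₃ ⟶ I.cocomplex.X 1) (hc : c ≫ I.cocomplex.d 1 2 = 0) :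
    ∃ θ : ∀ n, J.cocomplex.X n ⟶ I.cocomplex.X (n + 1), aug J ≫ θ 0 = c ∧
      ∀ n, J.cocomplex.d n (n + 1) ≫ θ (n + 1) = θ n ≫ I.cocomplex.d (n + 1) (n + 2) := by
  let p0 : J.cocomplex.X 0 ⟶ I.cocomplex.X 1 := Injective.factorThru c (aug J)
  have hp0 : aug J ≫ p0 = c := Injective.comp_factorThru _ _
  let q0 : {q : J.cocomplex.X 1 ⟶ I.cocomplex.X 2 //
      J.cocomplex.d 0 1 ≫ q = p0 ≫ I.cocomplex.d 1 2} :=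
    ⟨(aug_exact J).descToInjective (p0 ≫ I.cocomplex.d 1 2) (by
        dsimp; rw [reassoc_of% hp0, hc]), (aug_exact J).comp_descToInjective _ _⟩
  let Q : ∀ n, Σ p : J.cocomplex.X n ⟶ I.cocomplex.X (n + 1),
      {q : J.cocomplex.X (n + 1) ⟶ I.cocomplex.X (n + 2) //
        J.cocomplex.d n (n + 1) ≫ q = p ≫ I.cocomplex.d (n + 1) (n + 2)} :=
    fun n => Nat.rec (motive := fun n => Σ p : J.cocomplex.X n ⟶ I.cocomplex.X (n + 1),
      {q : J.cocomplex.X (n + 1) ⟶ I.cocomplex.X (n + 2) //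
        J.cocomplex.d n (n + 1) ≫ q = p ≫ I.cocomplex.d (n + 1) (n + 2)})
      ⟨p0, q0⟩ (fun n P => ⟨P.2.1, step I J n P.1 P.2⟩) n
  exact ⟨fun n => (Q n).1, hp0, fun n => (Q n).2.2⟩

variable (θ : ∀ n, J.cocomplex.X n ⟶ I.cocomplex.X (n + 1))

/-- The twisted differential on `I ⊞ J`. -/
noncomputable def twD (n : ℕ) : I.cocomplex.X n ⊞ J.cocomplex.X n ⟶
    I.cocomplex.X (n + 1) ⊞ J.cocomplex.X (n + 1) :=
  biprod.desc (I.cocomplex.d n (n + 1) ≫ biprod.inl)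
    (J.cocomplex.d n (n + 1) ≫ biprod.inr + ((-1 : ℤ) ^ (n + 1)) • (θ n ≫ biprod.inl))

lemma twD_comp (h : ∀ n, J.cocomplex.d n (n + 1) ≫ θ (n + 1) =
    θ n ≫ I.cocomplex.d (n + 1) (n + 2)) (n : ℕ) : twD I J θ n ≫ twD I J θ (n + 1) = 0 := by
  have h' := h n
  ext1
  · simp [twD]
  · simp only [twD, biprod.inr_desc_assoc, add_comp, Category.assoc, zsmul_comp, biprod.inr_desc,
      biprod.inl_desc, comp_add, comp_zsmul, HomologicalComplex.d_comp_d_assoc, zero_comp,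
      zero_add, comp_zero]
    rw [reassoc_of% h', pow_succ _ (n + 1)]
    simp

/-- The middle complex. -/
noncomputable def mid (h : ∀ n, J.cocomplex.d n (n + 1) ≫ θ (n + 1) =
    θ n ≫ I.cocomplex.d (n + 1) (n + 2)) : CochainComplex C ℕ :=
  CochainComplex.of (fun n => I.cocomplex.X n ⊞ J.cocomplex.X n) (twD I J θ) (twD_comp I J θ h)

variable (h : ∀ n, J.cocomplex.d n (n + 1) ≫ θ (n + 1) =
  θ n ≫ I.cocomplex.d (n + 1) (n + 2))

/-- The inclusion of the first resolution. -/
noncomputable def midInl : I.cocomplex ⟶ mid I J θ h where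
  f n := (biprod.inl : I.cocomplex.X n ⟶ I.cocomplex.X n ⊞ J.cocomplex.X n)
  comm' := by
    rintro i _ rfl
    simp [mid, twD]

/-- The projection to the third resolution. -/
noncomputable def midSnd : mid I J θ h ⟶ J.cocomplex where
  f n := (biprod.snd : I.cocomplex.X n ⊞ J.cocomplex.X n ⟶ J.cocomplex.X n)
  comm' := by
    rintro i _ rfl
    simp only [mid, CochainComplex.of_d, twD]
    ext1 <;> simp

lemma midInl_midSnd : midInl I J θ h ≫ midSnd I J θ h = 0 := by
  ext n
  exact biprod.inl_snd

lemma mid_shortExact : (ShortComplex.mk _ _ (midInl_midSnd I J θ h)).ShortExact :=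
  HomologicalComplex.shortExact_of_degreewise_shortExact _ fun n =>
    (ShortComplex.Splitting.ofHasBinaryBiproduct (I.cocomplex.X n) (J.cocomplex.X n)).shortExact

lemma mid_exactAt_succ (n : ℕ) : (mid I J θ h).ExactAt (n + 1) := by
  rw [HomologicalComplex.exactAt_iff_isZero_homology]
  refine ((mid_shortExact I J θ h).homology_exact₂ (n + 1)).isZero_X₂ ?_ ?_
  · exact IsZero.eq_of_src ((HomologicalComplex.exactAt_iff_isZero_homology _ _).1
      (I.cocomplex_exactAt_succ n)) _ _
  · exact IsZero.eq_of_tgt ((HomologicalComplex.exactAt_iff_isZero_homology _ _).1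
      (J.cocomplex_exactAt_succ n)) _ _

lemma mid_d (n : ℕ) : (mid I J θ h).d n (n + 1) = twD I J θ n := by
  simp only [mid, CochainComplex.of_d]

variable (b : S.X₂ ⟶ I.cocomplex.X 0)

/-- The augmentation of the middle complex. -/
noncomputable def midAug : S.X₂ ⟶ (mid I J θ h).X 0 :=
  biprod.lift b (S.g ≫ aug J)

lemma midAug_d (hθ : S.g ≫ aug J ≫ θ 0 = b ≫ I.cocomplex.d 0 1) :
    midAug I J θ h b ≫ (mid I J θ h).d 0 1 = 0 := by
  have h0 : (mid I J θ h).d 0 1 = twD I J θ 0 := mid_d I J θ h 0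
  rw [h0]
  change biprod.lift b (S.g ≫ aug J) ≫ twD I J θ 0 = 0
  have h1 := aug_d J
  rw [biprod.lift_eq]
  simp only [twD, add_comp, Category.assoc, biprod.inl_desc, biprod.inr_desc, comp_add]
  rw [reassoc_of% h1]
  simp only [zero_comp, comp_zero, zero_add, pow_one, neg_smul, one_smul, comp_neg]
  rw [← Category.assoc b, ← hθ]
  simp

lemma f_midAug (hb : S.f ≫ b = aug I) :
    S.f ≫ midAug I J θ h b = aug I ≫ (midInl I J θ h).f 0 := by
  change S.f ≫ biprod.lift b (S.g ≫ aug J) = aug I ≫ biprod.inl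
  ext1
  · simp [hb]
  · simp [S.zero_assoc]

lemma midAug_g : midAug I J θ h b ≫ (midSnd I J θ h).f 0 = S.g ≫ aug J :=
  biprod.lift_snd _ _

instance : Mono ((midInl I J θ h).f 0) :=
  inferInstanceAs (Mono (biprod.inl : I.cocomplex.X 0 ⟶ I.cocomplex.X 0 ⊞ J.cocomplex.X 0))

lemma mono_midAug (hS : S.ShortExact) (hb : S.f ≫ b = aug I) : Mono (midAug I J θ h b) := by
  have := hS.mono_f
  apply mono_of_cancel_zero
  intro A x hx
  have h1 : x ≫ S.g = 0 := by
    rw [← cancel_mono (aug J), Category.assoc, ← midAug_g I J θ h b, reassoc_of% hx]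
    simp
  have h2 : hS.exact.lift x h1 ≫ S.f = x := hS.exact.lift_f x h1
  rw [← h2] at hx ⊢
  rw [Category.assoc, f_midAug I J θ h b hb, ← Category.assoc] at hx
  have h3 := zero_of_comp_mono _ hx
  rw [zero_of_comp_mono _ h3, zero_comp]

lemma eq_fst_inl {A X Y : C} (w : A ⟶ X ⊞ Y) (hw : w ≫ (biprod.snd : X ⊞ Y ⟶ Y) = 0) :
    (w ≫ (biprod.fst : X ⊞ Y ⟶ X)) ≫ biprod.inl = w := by
  apply biprod.hom_ext
  · simp
  · simp [hw]

lemma midAug_exact (hS : S.ShortExact) (hb : S.f ≫ b = aug I)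
    (hθ : S.g ≫ aug J ≫ θ 0 = b ≫ I.cocomplex.d 0 1) :
    (ShortComplex.mk _ _ (midAug_d I J θ h b hθ)).Exact := by
  have := hS.epi_g
  rw [ShortComplex.exact_iff_exact_up_to_refinements]
  intro A x hx
  dsimp at x hx
  have h1 : (x ≫ (midSnd I J θ h).f 0) ≫ J.cocomplex.d 0 1 = 0 := by
    rw [Category.assoc, (midSnd I J θ h).comm, reassoc_of% hx, zero_comp]
  let z : A ⟶ S.X₃ := (aug_exact J).lift _ h1
  have hz : z ≫ aug J = x ≫ (midSnd I J θ h).f 0 := (aug_exact J).lift_f _ h1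
  obtain ⟨A', π, hπ, y, hy⟩ := surjective_up_to_refinements_of_epi S.g z
  let w := π ≫ x - y ≫ midAug I J θ h b
  have hw : w ≫ (midSnd I J θ h).f 0 = 0 := by
    simp only [w, sub_comp, Category.assoc, midAug_g, ← hz]
    rw [reassoc_of% hy, sub_self]
  have hwd : w ≫ (mid I J θ h).d 0 1 = 0 := by
    simp only [w, sub_comp, Category.assoc, hx, midAug_d I J θ h b hθ, comp_zero, sub_self]
  let i : A' ⟶ I.cocomplex.X 0 := w ≫ (biprod.fst : I.cocomplex.X 0 ⊞ J.cocomplex.X 0 ⟶ _)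
  have hi : i ≫ (midInl I J θ h).f 0 = w := by
    exact eq_fst_inl w hw
  have hid : i ≫ I.cocomplex.d 0 1 = 0 := by
    have : Mono ((midInl I J θ h).f 1) :=
      inferInstanceAs (Mono (biprod.inl : I.cocomplex.X 1 ⟶ I.cocomplex.X 1 ⊞ J.cocomplex.X 1))
    rw [← cancel_mono ((midInl I J θ h).f 1), Category.assoc, ← (midInl I J θ h).comm,
      reassoc_of% hi, hwd, zero_comp]
  have ht : (aug_exact I).lift i hid ≫ aug I = i := (aug_exact I).lift_f i hid
  refine ⟨A', π, hπ, y + (aug_exact I).lift i hid ≫ S.f, ?_⟩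
  dsimp
  rw [add_comp, Category.assoc, f_midAug I J θ h b hb, reassoc_of% ht, hi]
  simp [w]

lemma exists_resolvedSequence [EnoughInjectives C] (hS : S.ShortExact) :
    Nonempty (ResolvedSequence S) := by
  have := hS.mono_f
  have := hS.epi_g
  let I := injectiveResolution S.X₁
  let J := injectiveResolution S.X₃
  let b : S.X₂ ⟶ I.cocomplex.X 0 := Injective.factorThru (aug I) S.f
  have hb : S.f ≫ b = aug I := Injective.comp_factorThru _ _
  let c : S.X₃ ⟶ I.cocomplex.X 1 := hS.exact.desc (b ≫ I.cocomplex.d 0 1)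
    (by rw [reassoc_of% hb, aug_d])
  have hc : S.g ≫ c = b ≫ I.cocomplex.d 0 1 := hS.exact.g_desc _ _
  obtain ⟨θ, hθ0, h⟩ := exists_twist I J c (by
    rw [← cancel_epi S.g, reassoc_of% hc]
    simp)
  have hθ : S.g ≫ aug J ≫ θ 0 = b ≫ I.cocomplex.d 0 1 := by rw [hθ0, hc]
  let ι : (CochainComplex.single₀ C).obj S.X₂ ⟶ mid I J θ h :=
    (CochainComplex.fromSingle₀Equiv _ _).symm ⟨midAug I J θ h b, midAug_d I J θ h b hθ⟩
  have hι : ι.f 0 = midAug I J θ h b := CochainComplex.fromSingle₀Equiv_symm_apply_f_zero _ _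
  refine ⟨⟨I, ⟨mid I J θ h, ?_, ι, ?_⟩, J, midInl I J θ h, midSnd I J θ h,
    midInl_midSnd I J θ h, mid_shortExact I J θ h, ?_, ?_⟩⟩
  · intro n
    exact inferInstanceAs (Injective (I.cocomplex.X n ⊞ J.cocomplex.X n))
  · refine ⟨fun n => ?_⟩
    cases n with
    | zero =>
      rw [CochainComplex.quasiIsoAt₀_iff, ShortComplex.quasiIso_iff_of_zeros]
      · refine (ShortComplex.exact_and_mono_f_iff_of_iso ?_).2
          ⟨midAug_exact I J θ h b hS hb hθ, mono_midAug I J θ h b hS hb⟩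
        exact ShortComplex.isoMk (Iso.refl _) (Iso.refl _) (Iso.refl _) (by
          erw [Category.id_comp, Category.comp_id]
          exact hι.symm) (by
          erw [Category.id_comp, Category.comp_id]
          rfl)
      all_goals rfl
    | succ n =>
      rw [quasiIsoAt_iff_exactAt]
      · exact mid_exactAt_succ I J θ h n
      · exact CochainComplex.exactAt_succ_single_obj _ _
  · apply HomologicalComplex.from_single_hom_ext
    rw [HomologicalComplex.comp_f, HomologicalComplex.comp_f, CochainComplex.single₀_map_f_zero]
    exact (f_midAug I J θ h b hb).symm.trans (congrArg (S.f ≫ ·) hι.symm)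
  · apply HomologicalComplex.from_single_hom_ext
    rw [HomologicalComplex.comp_f, HomologicalComplex.comp_f, CochainComplex.single₀_map_f_zero]
    exact (congrArg (· ≫ (midSnd I J θ h).f 0) hι).trans (midAug_g I J θ h b)

end Horseshoe

end Horseshoe

section Delta

universe v₁ u₁ v₂ u₂

variable {C : Type u₁} [Category.{v₁} C] [Abelian C] {D : Type u₂} [Category.{v₂} D] [Abelian D]

lemma ResolvedSequence.map_shortExact {S : ShortComplex C} (P : ResolvedSequence S) (F : C ⥤ D)
    [F.Additive] : ((ShortComplex.mk P.f P.g P.zero).map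
      (F.mapHomologicalComplex (ComplexShape.up ℕ))).ShortExact := by
  refine HomologicalComplex.shortExact_of_degreewise_shortExact _ fun n => ?_
  have h := (HomologicalComplex.shortExact_iff_degreewise_shortExact _).1 P.shortExact n
  have : Injective ((ShortComplex.mk P.f P.g P.zero).map
      (HomologicalComplex.eval C (ComplexShape.up ℕ) n)).X₁ :=
    inferInstanceAs (Injective (P.res₁.cocomplex.X n))
  exact (h.splittingOfInjective.map F).shortExact

variable [EnoughInjectives C]

/-- The connecting homomorphism `R^n F(X₃) ⟶ R^(n+1) F(X₁)` of a short exact sequence: the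
connecting homomorphism of the short exact sequence of complexes obtained by applying `F` to a short
exact sequence of injective resolutions. -/
noncomputable def rightDerivedDelta (F : C ⥤ D) [F.Additive] {S : ShortComplex C}
    (hS : S.ShortExact) (n : ℕ) :
    (F.rightDerived n).obj S.X₃ ⟶ (F.rightDerived (n + 1)).obj S.X₁ :=
  let P := (Horseshoe.exists_resolvedSequence hS).some
  (P.res₃.isoRightDerivedObj F n).hom ≫ (P.map_shortExact F).δ n (n + 1) rfl ≫
    (P.res₁.isoRightDerivedObj F (n + 1)).inv

end Delta

section ExtDelta

variable {R : Type u} [Ring R] [TopologicalSpace R] [IsTopologicalRing R]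

/-- The connecting homomorphism `Ext^n(Z, S.X₃) → Ext^(n+1)(Z, S.X₁)` of a short exact sequence of
discrete modules. -/
noncomputable def extDelta (Z : PMod R) {S : ShortComplex (DMod R)} (hS : S.ShortExact) (n : ℕ) :
    ExtR Z S.X₃ n →+ ExtR Z S.X₁ (n + 1) :=
  (rightDerivedDelta (homFunctor Z) hS n).hom

/-- A pair of composable maps of profinite modules is a short exact sequence. -/
structure PMod.IsShortExact {Z' Z Z'' : PMod R} (i : Z' ⟶ Z) (q : Z ⟶ Z'') : Prop where
  injective : Function.Injective i.hom.hom
  exact : Function.Exact i.hom.hom q.hom.hom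
  surjective : Function.Surjective q.hom.hom

lemma PMod.exists_open_submodule [CompactSpace R] (Z : PMod R) (V : Set Z.obj) (hV : IsOpen V)
    (h0 : (0 : Z.obj) ∈ V) :
    ∃ U : Submodule Rᵐᵒᵖ Z.obj, IsOpen (U : Set Z.obj) ∧ (U : Set Z.obj) ⊆ V := by
  obtain ⟨h1, h2, h3⟩ := Z.property
  have : CompactSpace Rᵐᵒᵖ := MulOpposite.opHomeomorph.compactSpace
  obtain ⟨W, hW, h0W, hWV⟩ := compact_exists_isClopen_in_isOpen hV h0
  obtain ⟨H, hH⟩ := IsTopologicalAddGroup.exist_openAddSubgroup_sub_clopen_nhds_of_zero hW h0W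
  let U : Submodule Rᵐᵒᵖ Z.obj :=
    { carrier := {z | ∀ r : Rᵐᵒᵖ, r • z ∈ H}
      zero_mem' := fun r => by simp
      add_mem' := fun {a b} ha hb r => by
        rw [smul_add]
        exact H.add_mem (ha r) (hb r)
      smul_mem' := fun s z hz r => by
        rw [← mul_smul]
        exact hz _ }
  refine ⟨U, ?_, fun z hz => hWV (hH ?_)⟩
  · have hcl : IsClosed {p : Z.obj × Rᵐᵒᵖ | p.2 • p.1 ∉ H} := by
      have hc : Continuous fun p : Z.obj × Rᵐᵒᵖ => p.2 • p.1 := by fun_prop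
      exact (H.isOpen.preimage hc).isClosed_compl
    have := (isClosedMap_fst_of_compactSpace _ hcl).isOpen_compl
    convert this using 1
    ext z
    simp [U]
  · have := hz 1
    rwa [one_smul] at this

lemma isDiscreteMod_quotient {Z : PMod R} (U : Submodule Rᵐᵒᵖ Z.obj)
    (hU : IsOpen (U : Set Z.obj)) :
    IsDiscreteMod R (ModuleCat.of Rᵐᵒᵖ (Z.obj ⧸ U)) := by
  refine .of_isOpen_ann fun m => ?_
  obtain ⟨z, rfl⟩ := U.mkQ_surjective m
  have h : {r : Rᵐᵒᵖ | r • U.mkQ z = 0} = (fun r : Rᵐᵒᵖ => r • z) ⁻¹' (U : Set Z.obj) := by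
    ext r
    exact Submodule.Quotient.mk_eq_zero U (x := r • z)
  change IsOpen {r : Rᵐᵒᵖ | r • U.mkQ z = 0}
  rw [h]
  exact hU.preimage (by fun_prop)

lemma isLocallyConstant_mkQ {Z : PMod R} (U : Submodule Rᵐᵒᵖ Z.obj)
    (hU : IsOpen (U : Set Z.obj)) : IsLocallyConstant U.mkQ := by
  rw [IsLocallyConstant.iff_eventually_eq]
  intro z
  have : (fun w => w - z) ⁻¹' (U : Set Z.obj) ∈ nhds z :=
    (hU.preimage (by fun_prop)).mem_nhds (by simp)
  filter_upwards [this] with w hw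
  exact (Submodule.Quotient.eq U).2 hw

/-- Homomorphisms from a closed submodule to an injective discrete module extend. -/
lemma contHom_extend [CompactSpace R] {Z' Z : PMod R} (i : Z' ⟶ Z)
    (hi : Function.Injective i.hom.hom) (I : DMod R) [Injective I] (f : contHom Z' I) :
    ∃ g : contHom Z I, ∀ z, g.1 (i.hom.hom z) = f.1 z := by
  obtain ⟨_, _, _⟩ := Z.property
  obtain ⟨_, _, _⟩ := Z'.property
  have hemb : Topology.IsClosedEmbedding i.hom.hom :=
    i.hom.hom.continuous.isClosedEmbedding hi
  obtain ⟨W, hW, hWf⟩ := hemb.isInducing.isOpen_iff.1 (f.2.isOpen_fiber 0)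
  obtain ⟨U, hU, hUW⟩ := Z.exists_open_submodule W hW (by
    have h0 : (0 : Z'.obj) ∈ {x | f.1 x = 0} := map_zero f.1
    rw [← hWf] at h0
    simpa using h0)
  let N : Submodule Rᵐᵒᵖ Z'.obj := U.comap i.hom.hom.toLinearMap
  have hN : IsOpen (N : Set Z'.obj) := hU.preimage i.hom.hom.continuous
  let Q : DMod R := ⟨ModuleCat.of Rᵐᵒᵖ (Z.obj ⧸ U), isDiscreteMod_quotient U hU⟩
  let Q' : DMod R := ⟨ModuleCat.of Rᵐᵒᵖ (Z'.obj ⧸ N), isDiscreteMod_quotient N hN⟩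
  have hNf : N ≤ LinearMap.ker f.1 := fun z hz => by
    have h1 : z ∈ i.hom.hom ⁻¹' W := hUW hz
    rw [hWf] at h1
    exact h1
  let j : Q' ⟶ Q := ObjectProperty.homMk (ModuleCat.ofHom (N.mapQ U i.hom.hom.toLinearMap le_rfl))
  let φ : Q' ⟶ I := ObjectProperty.homMk (ModuleCat.ofHom (N.liftQ f.1 hNf))
  have hj : Mono j := by
    have : Mono ((IsDiscreteMod R).ι.map j) := by
      refine (ModuleCat.mono_iff_injective _).2 ?_
      refine (injective_iff_map_eq_zero (N.mapQ U i.hom.hom.toLinearMap le_rfl)).2 fun a ha => ?_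
      obtain ⟨z, rfl⟩ := N.mkQ_surjective a
      simpa [N] using ha
    exact (IsDiscreteMod R).ι.mono_of_mono_map this
  let ψ : Q ⟶ I := Injective.factorThru φ j
  have hψ : j ≫ ψ = φ := Injective.comp_factorThru φ j
  refine ⟨⟨ψ.hom.hom ∘ₗ U.mkQ, (isLocallyConstant_mkQ U hU).comp ψ.hom.hom⟩, fun z => ?_⟩
  have h1 : (j ≫ ψ).hom.hom (N.mkQ z) = φ.hom.hom (N.mkQ z) := by rw [hψ]
  exact h1

lemma PMod.IsShortExact.comp_eq_zero {Z' Z Z'' : PMod R} {i : Z' ⟶ Z} {q : Z ⟶ Z''}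
    (h : PMod.IsShortExact i q) : homPrecomp q ≫ homPrecomp i = 0 := by
  ext A f
  apply Subtype.ext
  ext z
  change f.1 (q.hom.hom (i.hom.hom z)) = 0
  rw [h.exact.apply_apply_eq_zero, map_zero]

/-- For `A` injective, `Hom(-, A)` is exact. -/
lemma PMod.IsShortExact.hom_shortExact [CompactSpace R] {Z' Z Z'' : PMod R} {i : Z' ⟶ Z}
    {q : Z ⟶ Z''} (h : PMod.IsShortExact i q) (A : DMod R) [Injective A] :
    (ShortComplex.mk ((homPrecomp q).app A) ((homPrecomp i).app A)
      (congr_app h.comp_eq_zero A)).ShortExact where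
  mono_f := by
    rw [AddCommGrpCat.mono_iff_injective]
    intro f g hfg
    apply Subtype.ext
    ext z
    obtain ⟨w, rfl⟩ := h.surjective z
    exact congrArg (fun k : contHom Z A => k.1 w) hfg
  epi_g := by
    rw [AddCommGrpCat.epi_iff_surjective]
    intro f
    obtain ⟨g, hg⟩ := contHom_extend i h.injective A f
    refine ⟨g, Subtype.ext (LinearMap.ext hg)⟩
  exact := by
    rw [ShortComplex.ab_exact_iff]
    intro (f : contHom Z A) hf
    obtain ⟨_, _, _⟩ := Z.property
    obtain ⟨_, _, _⟩ := Z''.property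
    have hf' : ∀ z, f.1 (i.hom.hom z) = 0 := fun z =>
      congrArg (fun k : contHom Z' A => k.1 z) hf
    have hker : LinearMap.ker q.hom.hom.toLinearMap ≤ LinearMap.ker f.1 := fun z hz => by
      obtain ⟨w, rfl⟩ := (h.exact z).1 hz
      exact hf' w
    let e := q.hom.hom.toLinearMap.quotKerEquivOfSurjective h.surjective
    let g : Z''.obj →ₗ[Rᵐᵒᵖ] A.obj := (Submodule.liftQ _ f.1 hker) ∘ₗ e.symm.toLinearMap
    have hg : ∀ z, g (q.hom.hom z) = f.1 z := fun z => by
      have h1 : e.symm (q.hom.hom z) = Submodule.Quotient.mk z := by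
        rw [LinearEquiv.symm_apply_eq]
        rfl
      change (Submodule.liftQ _ f.1 hker) (e.symm (q.hom.hom z)) = f.1 z
      rw [h1]
      rfl
    have hquot : Topology.IsQuotientMap q.hom.hom :=
      q.hom.hom.continuous.isClosedMap.isQuotientMap q.hom.hom.continuous h.surjective
    have hglc : IsLocallyConstant g := by
      intro s
      rw [← hquot.isOpen_preimage]
      have : q.hom.hom ⁻¹' (g ⁻¹' s) = f.1 ⁻¹' s := by
        ext z
        simp [hg]
      rw [this]
      exact f.2 s
    exact ⟨⟨g, hglc⟩, Subtype.ext (LinearMap.ext hg)⟩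

/-- The short exact sequence of complexes `0 → Hom(Z'', I) → Hom(Z, I) → Hom(Z', I) → 0`. -/
noncomputable def PMod.IsShortExact.complexes {Z' Z Z'' : PMod R} {i : Z' ⟶ Z} {q : Z ⟶ Z''}
    (h : PMod.IsShortExact i q) (K : CochainComplex (DMod R) ℕ) :
    ShortComplex (CochainComplex AddCommGrpCat.{u} ℕ) :=
  ShortComplex.mk ((NatTrans.mapHomologicalComplex (homPrecomp q) _).app K)
    ((NatTrans.mapHomologicalComplex (homPrecomp i) _).app K) (by
      ext n : 1
      exact congr_app h.comp_eq_zero (K.X n))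

lemma PMod.IsShortExact.complexes_shortExact [CompactSpace R] {Z' Z Z'' : PMod R} {i : Z' ⟶ Z}
    {q : Z ⟶ Z''} (h : PMod.IsShortExact i q) {A : DMod R} (I : InjectiveResolution A) :
    (h.complexes I.cocomplex).ShortExact :=
  HomologicalComplex.shortExact_of_degreewise_shortExact _ fun n =>
    h.hom_shortExact (I.cocomplex.X n)

/-- The connecting homomorphism `Ext^n(Z', A) → Ext^(n+1)(Z'', A)` of a short exact sequence
`0 → Z' → Z → Z'' → 0` of profinite modules: the connecting homomorphism of the short exact sequence
of complexes obtained by mapping it to an injective resolution of `A`. -/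
noncomputable def extDeltaPre [CompactSpace R] {Z' Z Z'' : PMod R} {i : Z' ⟶ Z} {q : Z ⟶ Z''}
    (h : PMod.IsShortExact i q) (A : DMod R) (n : ℕ) : ExtR Z' A n →+ ExtR Z'' A (n + 1) :=
  let I := injectiveResolution A
  ((I.isoRightDerivedObj (homFunctor Z') n).hom ≫ (h.complexes_shortExact I).δ n (n + 1) rfl ≫
    (I.isoRightDerivedObj (homFunctor Z'') (n + 1)).inv).hom

end ExtDelta

section Etale

open TopologicalSpace Topology

/-- The total space `⨆ x, G x × {x}` of a family of sets indexed by `X`. -/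
@[ext]
structure Tot {X : Type u} (G : X → Type u) where
  /-- the base point -/
  base : X
  /-- the element of the fibre -/
  val : G base

/-- The fibre square of the total space, with its topology as a subspace of the square. -/
@[reducible] def pairTop {X : Type u} (G : X → Type u) (τ : TopologicalSpace (Tot G)) :
    TopologicalSpace (Tot fun x => G x × G x) :=
  .induced (fun t => ((⟨t.base, t.val.1⟩, ⟨t.base, t.val.2⟩) : Tot G × Tot G)) inferInstance

/-- The pullback of the total space along `f : Y → X`, with its topology as a subspace of the
product of the total space with `Y`. -/
@[reducible] def pullTop {X Y : Type u} [TopologicalSpace Y] (f : Y → X) (G : X → Type u)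
    (τ : TopologicalSpace (Tot G)) : TopologicalSpace (Tot fun y => G (f y)) :=
  .induced (fun t => ((⟨f t.base, t.val⟩, t.base) : Tot G × Y)) inferInstance

lemma continuous_pullTop_fst {X Y : Type u} [TopologicalSpace Y] (f : Y → X) (G : X → Type u)
    (τ : TopologicalSpace (Tot G)) :
    Continuous[pullTop f G τ, τ] fun t => (⟨f t.base, t.val⟩ : Tot G) := by
  let _ := pullTop f G τ
  have h : Continuous fun t : Tot fun y => G (f y) => ((⟨f t.base, t.val⟩, t.base) : Tot G × Y) :=
    continuous_induced_dom
  exact continuous_fst.comp h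

lemma continuous_pullTop_base {X Y : Type u} [σ : TopologicalSpace Y] (f : Y → X) (G : X → Type u)
    (τ : TopologicalSpace (Tot G)) :
    Continuous[pullTop f G τ, σ] (Tot.base : (Tot fun y => G (f y)) → Y) := by
  let _ := pullTop f G τ
  have h : Continuous fun t : Tot fun y => G (f y) => ((⟨f t.base, t.val⟩, t.base) : Tot G × Y) :=
    continuous_induced_dom
  exact continuous_snd.comp h

/-- An étale space of (right) `R`-modules over the profinite space `X`. -/
structure EtaleMod (R : Type u) [Ring R] [TopologicalSpace R] (X : Profinite.{u}) where
  /-- the fibres -/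
  fib : X → DMod R
  /-- the topology on the total space -/
  [top : TopologicalSpace (Tot fun x => (fib x).obj)]
  isLocalHomeomorph : IsLocalHomeomorph (Tot.base : (Tot fun x => (fib x).obj) → X)
  continuous_zero : Continuous fun x : X => (⟨x, 0⟩ : Tot fun x => (fib x).obj)
  continuous_add : Continuous[pairTop _ top, top]
    fun t : Tot fun x => (fib x).obj × (fib x).obj => ⟨t.base, t.val.1 + t.val.2⟩
  continuous_smul : Continuous fun q : (Tot fun x => (fib x).obj) × Rᵐᵒᵖ =>
    (⟨q.1.base, q.2 • q.1.val⟩ : Tot fun x => (fib x).obj)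

variable {R : Type u} [Ring R] [TopologicalSpace R]

namespace EtaleMod

variable {X Y W : Profinite.{u}}

/-- The underlying family of sets of an étale space. -/
abbrev Fam (𝒜 : EtaleMod R X) : X → Type u := fun x => (𝒜.fib x).obj

instance (𝒜 : EtaleMod R X) : TopologicalSpace (Tot 𝒜.Fam) := 𝒜.top

lemma continuous_add_comp {T : Type u} [TopologicalSpace T] (𝒜 : EtaleMod R X) (f : T → X)
    (s t : ∀ y, 𝒜.Fam (f y)) (hs : Continuous fun y => (⟨f y, s y⟩ : Tot 𝒜.Fam))
    (ht : Continuous fun y => (⟨f y, t y⟩ : Tot 𝒜.Fam)) :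
    Continuous fun y => (⟨f y, s y + t y⟩ : Tot 𝒜.Fam) := by
  let _ := pairTop 𝒜.Fam 𝒜.top
  have h : Continuous fun y => (⟨f y, (s y, t y)⟩ : Tot fun x => 𝒜.Fam x × 𝒜.Fam x) :=
    continuous_induced_rng.2 (hs.prodMk ht)
  exact 𝒜.continuous_add.comp h

/-- The module of continuous maps `s : T → 𝒜` lifting `f : T → X`. -/
def liftSubmodule {T : Type u} [TopologicalSpace T] (𝒜 : EtaleMod R X) (f : C(T, X)) :
    Submodule Rᵐᵒᵖ (∀ y, 𝒜.Fam (f y)) where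
  carrier := {s | Continuous fun y => (⟨f y, s y⟩ : Tot 𝒜.Fam)}
  zero_mem' := 𝒜.continuous_zero.comp f.continuous
  add_mem' {s t} hs ht := 𝒜.continuous_add_comp f s t hs ht
  smul_mem' r s hs :=
    𝒜.continuous_smul.comp (Continuous.prodMk hs (continuous_const (y := r)))

lemma isOpen_zero (𝒜 : EtaleMod R X) : IsOpen (Set.range fun x : X => (⟨x, 0⟩ : Tot 𝒜.Fam)) :=
  (𝒜.isLocalHomeomorph.isOpenEmbedding_of_comp
    (f := fun x : X => (⟨x, 0⟩ : Tot 𝒜.Fam)) .id 𝒜.continuous_zero).isOpen_range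

variable [IsTopologicalRing R]

lemma isDiscreteMod_lift {T : Type u} [TopologicalSpace T] [CompactSpace T] (𝒜 : EtaleMod R X)
    (f : C(T, X)) : IsDiscreteMod R (ModuleCat.of Rᵐᵒᵖ (𝒜.liftSubmodule f)) := by
  refine .of_isOpen_ann fun s => ?_
  have hs : Continuous fun y => (⟨f y, s.1 y⟩ : Tot 𝒜.Fam) := s.2
  have hc : Continuous fun p : Rᵐᵒᵖ × T => (⟨f p.2, p.1 • s.1 p.2⟩ : Tot 𝒜.Fam) :=
    𝒜.continuous_smul.comp ((hs.comp continuous_snd).prodMk continuous_fst)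
  have hcl := isClosedMap_fst_of_compactSpace _ (𝒜.isOpen_zero.preimage hc).isClosed_compl
  convert hcl.isOpen_compl using 1
  have h0 : ∀ (x : X) (a : 𝒜.Fam x), (⟨x, a⟩ : Tot 𝒜.Fam) ∈
      Set.range (fun x : X => (⟨x, 0⟩ : Tot 𝒜.Fam)) ↔ a = 0 := by
    intro x a
    constructor
    · rintro ⟨x', hx⟩
      cases hx
      rfl
    · rintro rfl
      exact ⟨x, rfl⟩
  ext r
  simp only [Set.mem_compl_iff, Set.mem_image, Set.mem_preimage, h0, Set.mem_ofPred_eq]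
  constructor
  · rintro hr ⟨⟨r', y⟩, hy, rfl⟩
    exact hy (congrFun (congrArg Subtype.val hr) y)
  · intro h
    refine Subtype.ext (funext fun y => ?_)
    by_contra hy
    exact h ⟨(r, y), hy, rfl⟩

/-- The continuous product of `𝒜`: the discrete `R`-module of global sections. -/
def cprod (𝒜 : EtaleMod R X) : DMod R :=
  ⟨ModuleCat.of Rᵐᵒᵖ (𝒜.liftSubmodule (ContinuousMap.id X)), 𝒜.isDiscreteMod_lift _⟩

/-- The discrete `R`-module of sections of `𝒜` over the clopen set `U`. -/
def sectionsOn (𝒜 : EtaleMod R X) (U : Clopens X) : DMod R :=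
  have : CompactSpace U := isCompact_iff_compactSpace.1 U.isClosed.isCompact
  ⟨ModuleCat.of Rᵐᵒᵖ (𝒜.liftSubmodule ⟨((↑) : U → X), continuous_subtype_val⟩),
    𝒜.isDiscreteMod_lift _⟩

/-- Evaluation of global sections at `x`. -/
def ev (𝒜 : EtaleMod R X) (x : X) : 𝒜.cprod ⟶ 𝒜.fib x :=
  ObjectProperty.homMk (ModuleCat.ofHom
    ((LinearMap.proj (φ := 𝒜.Fam) x) ∘ₗ (𝒜.liftSubmodule (ContinuousMap.id X)).subtype))

/-- Evaluation of sections over `U` at `x ∈ U`. -/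
def evOn (𝒜 : EtaleMod R X) (U : Clopens X) (x : U) : 𝒜.sectionsOn U ⟶ 𝒜.fib x :=
  ObjectProperty.homMk (ModuleCat.ofHom
    ((LinearMap.proj (φ := fun x : U => 𝒜.Fam x) x) ∘ₗ (𝒜.liftSubmodule _).subtype))

/-- A morphism of étale spaces of `R`-modules `(𝒜, X) → (ℬ, Y)` over the continuous map
`f : Y → X`. -/
@[ext]
structure Hom (f : C(Y, X)) (𝒜 : EtaleMod R X) (ℬ : EtaleMod R Y) where
  /-- the homomorphisms on fibres -/
  app : ∀ y, 𝒜.fib (f y) ⟶ ℬ.fib y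
  cont : Continuous[pullTop f 𝒜.Fam 𝒜.top, ℬ.top]
    fun t : Tot fun y => 𝒜.Fam (f y) => ⟨t.base, (app t.base).hom.hom t.val⟩

lemma Hom.continuous_comp {f : C(Y, X)} {𝒜 : EtaleMod R X} {ℬ : EtaleMod R Y} (φ : Hom f 𝒜 ℬ)
    {T : Type u} [TopologicalSpace T] (g : C(T, Y)) (s : ∀ t, 𝒜.Fam (f (g t)))
    (hs : Continuous fun t => (⟨f (g t), s t⟩ : Tot 𝒜.Fam)) :
    Continuous fun t => (⟨g t, (φ.app (g t)).hom.hom (s t)⟩ : Tot ℬ.Fam) := by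
  let _ := pullTop f 𝒜.Fam 𝒜.top
  have h : Continuous fun t => (⟨g t, s t⟩ : Tot fun y => 𝒜.Fam (f y)) :=
    continuous_induced_rng.2 (hs.prodMk g.continuous)
  exact φ.cont.comp h

/-- The map on continuous products induced by a morphism of étale spaces. -/
def Hom.cprodMap {f : C(Y, X)} {𝒜 : EtaleMod R X} {ℬ : EtaleMod R Y} (φ : Hom f 𝒜 ℬ) :
    𝒜.cprod ⟶ ℬ.cprod :=
  ObjectProperty.homMk (ModuleCat.ofHom
    { toFun := fun s => ⟨fun y => (φ.app y).hom.hom (s.1 (f y)),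
        φ.continuous_comp (ContinuousMap.id Y) (fun y => s.1 (f y)) (s.2.comp f.continuous)⟩
      map_add' := fun s t => Subtype.ext (funext fun y => map_add (φ.app y).hom.hom _ _)
      map_smul' := fun r s => Subtype.ext (funext fun y => map_smul (φ.app y).hom.hom _ _) })

/-- Étale spaces of `R`-modules over a fixed profinite space. -/
instance : Category (EtaleMod R X) where
  Hom 𝒜 ℬ := Hom (ContinuousMap.id X) 𝒜 ℬ
  id 𝒜 := ⟨fun x => 𝟙 (𝒜.fib x), continuous_pullTop_fst (ContinuousMap.id X) 𝒜.Fam 𝒜.top⟩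
  comp {𝒜 ℬ 𝒞} φ ψ := ⟨fun x => φ.app x ≫ ψ.app x,
    let _ := pullTop (ContinuousMap.id X) 𝒜.Fam 𝒜.top
    ψ.continuous_comp (T := Tot fun x => 𝒜.Fam (ContinuousMap.id X x))
      ⟨Tot.base, continuous_pullTop_base (ContinuousMap.id X) 𝒜.Fam 𝒜.top⟩
      (fun t => (φ.app t.base).hom.hom t.val) φ.cont⟩
  id_comp φ := Hom.ext (funext fun x => Category.id_comp (φ.app x))
  comp_id φ := Hom.ext (funext fun x => Category.comp_id (φ.app x))
  assoc φ ψ χ := Hom.ext (funext fun x => Category.assoc (φ.app x) (ψ.app x) (χ.app x))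

end EtaleMod

end Etale

section EtaleExact

open TopologicalSpace Topology

variable {R : Type u} [Ring R] [TopologicalSpace R] [IsTopologicalRing R]

lemma DMod.shortExact_of {S : ShortComplex (DMod R)} (hf : Function.Injective S.f.hom.hom)
    (h : Function.Exact S.f.hom.hom S.g.hom.hom) (hg : Function.Surjective S.g.hom.hom) :
    S.ShortExact := by
  have : ∀ {A B : DMod R} (f : A ⟶ B), PreservesLimit (parallelPair f 0) (IsDiscreteMod R).ι :=
    fun f => (IsDiscreteMod R).preservesKernels_ι f
  have : ∀ {A B : DMod R} (f : A ⟶ B), PreservesColimit (parallelPair f 0) (IsDiscreteMod R).ι :=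
    fun f => (IsDiscreteMod R).preservesCokernels_ι f
  have hp : (IsDiscreteMod R).ι.PreservesHomology := { }
  have hm : Mono S.f :=
    (IsDiscreteMod R).ι.mono_of_mono_map ((ModuleCat.mono_iff_injective _).2 hf)
  have he : Epi S.g :=
    (IsDiscreteMod R).ι.epi_of_epi_map ((ModuleCat.epi_iff_surjective _).2 hg)
  refine ShortComplex.ShortExact.mk ?_
  rw [← ShortComplex.exact_map_iff_of_faithful S (IsDiscreteMod R).ι]
  exact (ShortComplex.ShortExact.moduleCat_exact_iff_function_exact _).2 h

namespace EtaleMod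

variable {X Y : Profinite.{u}} {𝒜' 𝒜 𝒜'' : EtaleMod R X}

/-- A pair of composable maps of étale spaces over `X` is a short exact sequence if it is one on
every fibre. -/
structure IsShortExact (φ : 𝒜' ⟶ 𝒜) (ψ : 𝒜 ⟶ 𝒜'') : Prop where
  injective : ∀ x, Function.Injective (Hom.app φ x).hom.hom
  exact : ∀ x, Function.Exact (Hom.app φ x).hom.hom (Hom.app ψ x).hom.hom
  surjective : ∀ x, Function.Surjective (Hom.app ψ x).hom.hom

variable {φ : 𝒜' ⟶ 𝒜} {ψ : 𝒜 ⟶ 𝒜''}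

/-- The short exact sequence on the fibres over `x`. -/
def IsShortExact.fibSeq (h : IsShortExact φ ψ) (x : X) : ShortComplex (DMod R) where
  X₁ := 𝒜'.fib x
  X₂ := 𝒜.fib x
  X₃ := 𝒜''.fib x
  f := Hom.app φ x
  g := Hom.app ψ x
  zero := by
    ext a
    exact (h.exact x).apply_apply_eq_zero a

lemma IsShortExact.fibSeq_shortExact (h : IsShortExact φ ψ) (x : X) :
    (h.fibSeq x).ShortExact :=
  DMod.shortExact_of (h.injective x) (h.exact x) (h.surjective x)

/-- The sequence of modules of global sections. -/
def IsShortExact.cprodSeq (h : IsShortExact φ ψ) : ShortComplex (DMod R) where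
  X₁ := 𝒜'.cprod
  X₂ := 𝒜.cprod
  X₃ := 𝒜''.cprod
  f := Hom.cprodMap φ
  g := Hom.cprodMap ψ
  zero := by
    ext s
    exact Subtype.ext (funext fun x => (h.exact x).apply_apply_eq_zero (s.1 x))

lemma eventually_eq_of_eq {𝒜 : EtaleMod R X} {x : X} {s t : ∀ y, 𝒜.Fam y}
    (hs : ContinuousAt (fun y => (⟨y, s y⟩ : Tot 𝒜.Fam)) x)
    (ht : ContinuousAt (fun y => (⟨y, t y⟩ : Tot 𝒜.Fam)) x) (h : s x = t x) :
    ∀ᶠ y in 𝓝 x, s y = t y := by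
  obtain ⟨W, hW, hxW, hinj⟩ := 𝒜.isLocalHomeomorph.isLocallyInjective ⟨x, s x⟩
  have h1 := hs (hW.mem_nhds hxW)
  have hxW' : (⟨x, t x⟩ : Tot 𝒜.Fam) ∈ W := by
    rw [← h]
    exact hxW
  have h2 := ht (hW.mem_nhds hxW')
  filter_upwards [h1, h2] with y hy1 hy2
  exact eq_of_heq (Tot.mk.inj (hinj hy1 hy2 rfl)).2

lemma exists_local_section (𝒜 : EtaleMod R X) (x : X) (a : 𝒜.Fam x) :
    ∃ s : ∀ y, 𝒜.Fam y, s x = a ∧ ∀ᶠ y in 𝓝 x, ContinuousAt (fun y => (⟨y, s y⟩ : Tot 𝒜.Fam)) y := by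
  obtain ⟨e, he, hbase⟩ := 𝒜.isLocalHomeomorph ⟨x, a⟩
  classical
  let s : ∀ y, 𝒜.Fam y := fun y =>
    if h : (e.symm y).base = y then h ▸ (e.symm y).val else 0
  have hs : ∀ y ∈ e.target, (⟨y, s y⟩ : Tot 𝒜.Fam) = e.symm y := by
    intro y hy
    have h1 : (e.symm y).base = y := by
      have := e.right_inv hy
      rwa [← hbase] at this
    have : s y = h1 ▸ (e.symm y).val := dif_pos h1
    rw [this]
    generalize e.symm y = t at h1
    subst h1
    rfl
  have hx : x ∈ e.target := by
    have := e.map_source he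
    rwa [← hbase] at this
  have hxa : e.symm x = ⟨x, a⟩ := by
    have := e.left_inv he
    rwa [← hbase] at this
  refine ⟨s, ?_, ?_⟩
  · exact eq_of_heq (Tot.mk.inj ((hs x hx).trans hxa)).2
  · filter_upwards [e.open_target.mem_nhds hx] with y hy
    refine (e.symm.continuousAt hy).congr ?_
    filter_upwards [e.open_target.mem_nhds hy] with z hz
    exact (hs z hz).symm

lemma Hom.continuousAt {f : C(Y, X)} {𝒜 : EtaleMod R X} {ℬ : EtaleMod R Y} (φ : Hom f 𝒜 ℬ)
    (s : ∀ y, 𝒜.Fam (f y)) (y : Y) (hs : ContinuousAt (fun y => (⟨f y, s y⟩ : Tot 𝒜.Fam)) y) :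
    ContinuousAt (fun y => (⟨y, (φ.app y).hom.hom (s y)⟩ : Tot ℬ.Fam)) y := by
  let _ := pullTop f 𝒜.Fam 𝒜.top
  have h : ContinuousAt (fun y => (⟨y, s y⟩ : Tot fun y => 𝒜.Fam (f y))) y := by
    have hi : IsInducing fun t : Tot fun y => 𝒜.Fam (f y) =>
        ((⟨f t.base, t.val⟩, t.base) : Tot 𝒜.Fam × Y) := ⟨rfl⟩
    rw [hi.continuousAt_iff]
    exact hs.prodMk continuousAt_id
  exact φ.cont.continuousAt.comp h

lemma IsShortExact.cprod_surjective (h : IsShortExact φ ψ) :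
    Function.Surjective (Hom.cprodMap ψ).hom.hom := by
  intro s
  have key : ∃ U : Set X, IsClopen U ∧ Set.univ ⊆ U ∧ ∃ r : ∀ y, 𝒜.Fam y, ∀ y ∈ U,
      ContinuousAt (fun y => (⟨y, r y⟩ : Tot 𝒜.Fam)) y ∧ (Hom.app ψ y).hom.hom (r y) = s.1 y := by
    refine IsCompact.induction_on (p := fun K => ∃ U : Set X, IsClopen U ∧ K ⊆ U ∧
      ∃ r : ∀ y, 𝒜.Fam y, ∀ y ∈ U, ContinuousAt (fun y => (⟨y, r y⟩ : Tot 𝒜.Fam)) y ∧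
        (Hom.app ψ y).hom.hom (r y) = s.1 y) isCompact_univ ?_ ?_ ?_ ?_
    · exact ⟨∅, isClopen_empty, subset_rfl, fun _ => 0, by simp⟩
    · rintro K L hKL ⟨U, hU, hLU, r, hr⟩
      exact ⟨U, hU, hKL.trans hLU, r, hr⟩
    · rintro K L ⟨U, hU, hKU, r, hr⟩ ⟨V, hV, hLV, t, ht⟩
      classical
      refine ⟨U ∪ V, hU.union hV, Set.union_subset_union hKU hLV,
        fun y => if y ∈ U then r y else t y, fun y hy => ?_⟩
      by_cases hyU : y ∈ U
      · refine ⟨(hr y hyU).1.congr ?_, by simpa [hyU] using (hr y hyU).2⟩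
        filter_upwards [hU.isOpen.mem_nhds hyU] with z hz
        simp [hz]
      · have hyV : y ∈ V := hy.resolve_left hyU
        refine ⟨(ht y hyV).1.congr ?_, by simpa [hyU] using (ht y hyV).2⟩
        filter_upwards [hU.compl.isOpen.mem_nhds hyU] with z hz
        simp [show z ∉ U from hz]
    · intro x _
      obtain ⟨a, ha⟩ := h.surjective x (s.1 x)
      obtain ⟨r, hrx, hr⟩ := 𝒜.exists_local_section x a
      have hs : ∀ y, ContinuousAt (fun y => (⟨y, s.1 y⟩ : Tot 𝒜''.Fam)) y :=
        fun y => Continuous.continuousAt s.2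
      have h1 := eventually_eq_of_eq (Hom.continuousAt ψ r x hr.self_of_nhds) (hs x)
        (by rw [hrx]; exact ha)
      obtain ⟨V, hV, hVo, hxV⟩ := mem_nhds_iff.1 (hr.and h1)
      obtain ⟨U, hU, hxU, hUV⟩ := compact_exists_isClopen_in_isOpen hVo hxV
      exact ⟨U, mem_nhdsWithin_of_mem_nhds (hU.isOpen.mem_nhds hxU), U, hU, subset_rfl, r,
        fun y hy => hV (hUV hy)⟩
  obtain ⟨U, _, hU, r, hr⟩ := key
  exact ⟨⟨r, continuous_iff_continuousAt.2 fun y => (hr y (hU trivial)).1⟩,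
    Subtype.ext (funext fun y => (hr y (hU trivial)).2)⟩

lemma IsShortExact.cprodSeq_shortExact (h : IsShortExact φ ψ) : h.cprodSeq.ShortExact := by
  refine DMod.shortExact_of ?_ ?_ h.cprod_surjective
  · intro s t hst
    exact Subtype.ext (funext fun x => h.injective x (congrFun (congrArg Subtype.val hst) x))
  · intro s
    constructor
    · intro hs
      have hs' : ∀ x, (Hom.app ψ x).hom.hom (s.1 x) = 0 := fun x =>
        congrFun (congrArg Subtype.val hs) x
      choose r hr using fun x => (h.exact x (s.1 x)).1 (hs' x)
      refine ⟨⟨r, continuous_iff_continuousAt.2 fun x => ?_⟩,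
        Subtype.ext (funext fun x => hr x)⟩
      obtain ⟨t, htx, ht⟩ := 𝒜'.exists_local_section x (r x)
      have hsx : ∀ y, ContinuousAt (fun y => (⟨y, s.1 y⟩ : Tot 𝒜.Fam)) y :=
        fun y => Continuous.continuousAt s.2
      have h1 := eventually_eq_of_eq (Hom.continuousAt φ t x ht.self_of_nhds) (hsx x)
        (by rw [htx]; exact hr x)
      refine ht.self_of_nhds.congr ?_
      filter_upwards [h1] with y hy
      have : t y = r y := h.injective y (hy.trans (hr y).symm)
      exact congrArg (Tot.mk (G := 𝒜'.Fam) y) this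
    · rintro ⟨r, rfl⟩
      exact Subtype.ext (funext fun x => (h.exact x).apply_apply_eq_zero (r.1 x))

end EtaleMod

end EtaleExact

section ExtEtale

open TopologicalSpace Topology

/-- A topology on the total space of a family of abelian groups over the profinite space `X` makes
it an étale space of discrete torsion abelian groups (the same as discrete modules over the
profinite completion of `ℤ`). -/
structure IsEtaleTorsion {X : Profinite.{u}} (G : X → Type u) [∀ x, AddCommGroup (G x)]
    (τ : TopologicalSpace (Tot G)) : Prop where
  isLocalHomeomorph : IsLocalHomeomorph (Tot.base : Tot G → X)
  continuous_zero : Continuous fun x : X => (⟨x, 0⟩ : Tot G)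
  continuous_add : Continuous[pairTop G τ, τ]
    fun t : Tot fun x => G x × G x => ⟨t.base, t.val.1 + t.val.2⟩
  continuous_neg : Continuous fun t : Tot G => (⟨t.base, -t.val⟩ : Tot G)
  torsion : ∀ x, IsAddTorsion (G x)

/-- The continuous product (group of global sections) of an étale space of discrete torsion abelian
groups. -/
def IsEtaleTorsion.cprod {X : Profinite.{u}} {G : X → Type u} [∀ x, AddCommGroup (G x)]
    {τ : TopologicalSpace (Tot G)} (h : IsEtaleTorsion G τ) : AddSubgroup (∀ x, G x) where
  carrier := {s | Continuous fun x => (⟨x, s x⟩ : Tot G)}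
  zero_mem' := h.continuous_zero
  add_mem' {s t} hs ht := by
    let _ := pairTop G τ
    have hp : Continuous fun x => (⟨x, (s x, t x)⟩ : Tot fun x => G x × G x) :=
      continuous_induced_rng.2 (Continuous.prodMk hs ht)
    exact h.continuous_add.comp hp
  neg_mem' hs := h.continuous_neg.comp hs

variable {R : Type u} [Ring R] [TopologicalSpace R] [IsTopologicalRing R]

/-- The family of groups `Ext_R^n(Z, A_x)`. -/
abbrev ExtFam (Z : PMod R) {X : Profinite.{u}} (𝒜 : EtaleMod R X) (n : ℕ) : X → Type u :=
  fun x => ExtR Z (𝒜.fib x) n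

/-- The topology on the disjoint union of the groups `Ext_R^n(Z, A_x)`: it is generated by the sets
of germs `{(s|_x, x) | x ∈ U}` of elements `s ∈ Ext_R^n(Z, 𝒜(U))` for `U ⊆ X` clopen. -/
@[reducible] def extTop (Z : PMod R) {X : Profinite.{u}} (𝒜 : EtaleMod R X) (n : ℕ) :
    TopologicalSpace (Tot (ExtFam Z 𝒜 n)) :=
  .generateFrom {O | ∃ (U : Clopens X) (s : ExtR Z (𝒜.sectionsOn U) n),
    O = Set.range fun x : U => (⟨x, extPost Z (𝒜.evOn U x) n s⟩ : Tot (ExtFam Z 𝒜 n))}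

end ExtEtale

section DeltaFunctor

universe w v₁ u₁

/-- The structure of a (covariant) cohomological δ-functor on a family of abelian groups `T n A`,
for `A` in a category with a distinguished class of short exact sequences. -/
structure CohomologicalDeltaFunctor (C : Type u₁) [Category.{v₁} C]
    (exactSeq : ∀ {A B D : C}, (A ⟶ B) → (B ⟶ D) → Prop)
    (T : ℕ → C → Type w) [∀ n A, AddCommGroup (T n A)] where
  /-- the action on morphisms -/
  map : ∀ (n : ℕ) {A B : C}, (A ⟶ B) → (T n A →+ T n B)
  map_id : ∀ (n : ℕ) (A : C), map n (𝟙 A) = AddMonoidHom.id (T n A)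
  map_comp : ∀ (n : ℕ) {A B D : C} (f : A ⟶ B) (g : B ⟶ D),
    map n (f ≫ g) = (map n g).comp (map n f)
  /-- the connecting homomorphisms -/
  δ : ∀ (n : ℕ) {A B D : C} (f : A ⟶ B) (g : B ⟶ D), exactSeq f g → (T n D →+ T (n + 1) A)
  δ_naturality : ∀ (n : ℕ) {A B D A' B' D' : C} (f : A ⟶ B) (g : B ⟶ D) (h : exactSeq f g)
    (f' : A' ⟶ B') (g' : B' ⟶ D') (h' : exactSeq f' g') (a : A ⟶ A') (b : B ⟶ B') (d : D ⟶ D'),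
    f ≫ b = a ≫ f' → g ≫ d = b ≫ g' →
      (map (n + 1) a).comp (δ n f g h) = (δ n f' g' h').comp (map n d)
  injective_zero : ∀ {A B D : C} (f : A ⟶ B) (g : B ⟶ D), exactSeq f g →
    Function.Injective (map 0 f)
  exact_middle : ∀ (n : ℕ) {A B D : C} (f : A ⟶ B) (g : B ⟶ D), exactSeq f g →
    Function.Exact (map n f) (map n g)
  exact_right : ∀ (n : ℕ) {A B D : C} (f : A ⟶ B) (g : B ⟶ D) (h : exactSeq f g),
    Function.Exact (map n g) (δ n f g h)
  exact_left : ∀ (n : ℕ) {A B D : C} (f : A ⟶ B) (g : B ⟶ D) (h : exactSeq f g),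
    Function.Exact (δ n f g h) (map (n + 1) f)

/-- An isomorphism of cohomological δ-functors. -/
structure CohomologicalDeltaFunctor.Iso {C : Type u₁} [Category.{v₁} C]
    {exactSeq : ∀ {A B D : C}, (A ⟶ B) → (B ⟶ D) → Prop}
    {T T' : ℕ → C → Type w} [∀ n A, AddCommGroup (T n A)] [∀ n A, AddCommGroup (T' n A)]
    (L : CohomologicalDeltaFunctor C exactSeq T) (L' : CohomologicalDeltaFunctor C exactSeq T') where
  /-- the isomorphisms of groups -/
  equiv : ∀ n A, T n A ≃+ T' n A
  map_comm : ∀ (n : ℕ) {A B : C} (f : A ⟶ B) (t : T n A),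
    equiv n B (L.map n f t) = L'.map n f (equiv n A t)
  δ_comm : ∀ (n : ℕ) {A B D : C} (f : A ⟶ B) (g : B ⟶ D) (h : exactSeq f g) (t : T n D),
    equiv (n + 1) A (L.δ n f g h t) = L'.δ n f g h (equiv n D t)

end DeltaFunctor

/-!
Elements of `Ext_R^n(Z, ∏ 𝒜)` behave like global sections of a sheaf on `X`: a clopen `U` acts by
cutting sections of `𝒜` off outside `U`, which makes `extTop` a topology of germs, and since `X` is
compact, finitely many germs glue to a single global element. So everything reduces to the stalks:
the group of germs at `x` must be `Ext_R^n(Z, A_x)`. Now `A_x` is the filtered colimit of the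
modules `𝒜(U)` over the clopen neighbourhoods `U` of `x`, and `Ext_R^n(Z, -)` commutes with filtered
colimits of discrete modules. For `n = 0` this is because a continuous map from a compact space to a
discrete module takes finitely many values; higher `n` follow by dimension shifting in `Z` along a
free profinite cover, whose higher `Ext` groups vanish.

The connecting homomorphisms of `∏ Ext_R^n(Z, A_x)` are transported from `Ext_R^n(Z, ∏ 𝒜)`; they are
the fibrewise ones because evaluation at `x` is a map of short exact sequences.
-/

section HomologicalAlgebra

open Preadditive HomologicalComplex

universe v₁ u₁ v₂ u₂

variable {C : Type u₁} [Category.{v₁} C] [Abelian C] {D : Type u₂} [Category.{v₂} D] [Abelian D]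

lemma mono_homologyMap_zero {K L : CochainComplex D ℕ} (f : K ⟶ L) [Mono (f.f 0)] :
    Mono (homologyMap f 0) := by
  have hcycles : Mono (cyclesMap f 0) := by
    have : Mono (cyclesMap f 0 ≫ L.iCycles 0) := by
      rw [cyclesMap_i]
      infer_instance
    exact mono_of_mono _ (L.iCycles 0)
  have hcomp : Mono (homologyMap f 0 ≫ L.isoHomologyπ₀.inv) := by
    rw [CochainComplex.isoHomologyπ₀_inv_naturality]
    infer_instance
  exact mono_of_mono _ L.isoHomologyπ₀.inv

lemma exists_comp_nullHomotopicMap_eq_sub {ι : Type*} {c : ComplexShape ι}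
    {K L M : HomologicalComplex C c} (f : K ⟶ L) [∀ n, Mono (f.f n)] [∀ n, Injective (M.X n)]
    {α β : K ⟶ M} (H : Homotopy α β) :
    ∃ k : ∀ i j, L.X i ⟶ M.X j, f ≫ Homotopy.nullHomotopicMap k = α - β := by
  let k : ∀ i j, L.X i ⟶ M.X j := fun i j => Injective.factorThru (H.hom i j) (f.f i)
  have hk : ∀ i j, f.f i ≫ k i j = H.hom i j := fun i j => Injective.comp_factorThru _ _
  refine ⟨k, ?_⟩
  rw [Homotopy.comp_nullHomotopicMap]
  ext n
  simp only [hk, HomologicalComplex.sub_f_apply, H.comm n, add_sub_cancel_right]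
  rfl

lemma ι_comp_nullHomotopicMap {X : C} (I : InjectiveResolution X) {M : CochainComplex C ℕ}
    (k : ∀ i j, I.cocomplex.X i ⟶ M.X j) : I.ι ≫ Homotopy.nullHomotopicMap k = 0 := by
  apply from_single_hom_ext
  have h : (Homotopy.nullHomotopicMap k).f 0 = I.cocomplex.d 0 1 ≫ k 1 0 :=
    Homotopy.nullHomotopicMap_f_of_not_rel_right (c := ComplexShape.up ℕ) (by simp) (by simp) k
  rw [comp_f, h, ← Category.assoc, I.ι_f_zero_comp_complex_d, zero_comp, zero_f]

instance [HasInjectiveResolutions C] (F : C ⥤ D) [F.Additive] (n : ℕ) :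
    (F.rightDerived n).Additive where
  map_add {X Y f g} := by
    let I := injectiveResolution X
    let J := injectiveResolution Y
    have hf := InjectiveResolution.desc_commutes f J I
    have hg := InjectiveResolution.desc_commutes g J I
    rw [F.rightDerived_map_eq n f _ hf, F.rightDerived_map_eq n g _ hg,
      F.rightDerived_map_eq n (f + g) (InjectiveResolution.desc f J I +
        InjectiveResolution.desc g J I) (by rw [comp_add, hf, hg, Functor.map_add, add_comp]),
      Functor.map_add, add_comp, comp_add]

section RightDerivedObjIso

variable [EnoughInjectives C] (F : C ⥤ D) [F.Additive]

/-- The value of a right derived functor as the homology of `F` applied to any injective resolution: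
`InjectiveResolution.isoRightDerivedObj`, with its target written as a homology object. -/
noncomputable def rightDerivedObjIso {X : C} (I : InjectiveResolution X) (n : ℕ) :
    (F.rightDerived n).obj X ≅
      ((F.mapHomologicalComplex (ComplexShape.up ℕ)).obj I.cocomplex).homology n :=
  I.isoRightDerivedObj F n

lemma rightDerived_map_comp_rightDerivedObjIso {X Y : C} (f : X ⟶ Y)
    (I : InjectiveResolution X) (J : InjectiveResolution Y) (φ : I.cocomplex ⟶ J.cocomplex)
    (h : I.ι ≫ φ = (CochainComplex.single₀ C).map f ≫ J.ι) (n : ℕ) :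
    (F.rightDerived n).map f ≫ (rightDerivedObjIso F J n).hom = (rightDerivedObjIso F I n).hom ≫
      homologyMap ((F.mapHomologicalComplex _).map φ) n :=
  I.isoRightDerivedObj_hom_naturality f J φ (by simpa using congr_hom h 0) F n

lemma rightDerived_app_comp_rightDerivedObjIso {G : C ⥤ D} [G.Additive] (α : F ⟶ G) {X : C}
    (I : InjectiveResolution X) (n : ℕ) :
    (NatTrans.rightDerived α n).app X ≫ (rightDerivedObjIso G I n).hom =
      (rightDerivedObjIso F I n).hom ≫
        homologyMap ((NatTrans.mapHomologicalComplex α (ComplexShape.up ℕ)).app I.cocomplex) n := by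
  have h : (NatTrans.rightDerived α n).app X = (rightDerivedObjIso F I n).hom ≫
      homologyMap ((NatTrans.mapHomologicalComplex α (ComplexShape.up ℕ)).app I.cocomplex) n ≫
        (rightDerivedObjIso G I n).inv := I.rightDerived_app_eq α n
  rw [h, Category.assoc, Category.assoc, Iso.inv_hom_id, Category.comp_id]

lemma isZero_rightDerived_obj_succ [PreservesFiniteLimits F] [F.PreservesEpimorphisms] (n : ℕ)
    (A : C) : IsZero ((F.rightDerived (n + 1)).obj A) := by
  have : F.PreservesHomology := F.preservesHomology_of_preservesEpis_and_kernels
  let I := injectiveResolution A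
  refine IsZero.of_iso ?_ (rightDerivedObjIso F I (n + 1))
  rw [← HomologicalComplex.exactAt_iff_isZero_homology]
  exact (I.cocomplex_exactAt_succ n).map F

end RightDerivedObjIso

section ConjDelta

variable {ι : Type*} {c : ComplexShape ι} {K K' : ShortComplex (HomologicalComplex D c)}
  (hK : K.ShortExact) (hK' : K'.ShortExact) {i j : ι} (hij : c.Rel i j) {A B A' B' M : D}
  (a : A ≅ K.X₁.homology j) (b : B ≅ K.X₃.homology i)
  (a' : A' ≅ K'.X₁.homology j) (b' : B' ≅ K'.X₃.homology i)

/-- The connecting homomorphism of a short exact sequence of complexes, conjugated by isomorphisms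
of the outer homology objects with given objects. -/
noncomputable def conjDelta : B ⟶ A := b.hom ≫ hK.δ i j hij ≫ a.inv

lemma conjDelta_comp_hom : conjDelta hK hij a b ≫ a.hom = b.hom ≫ hK.δ i j hij := by
  simp [conjDelta]

lemma conjDelta_naturality (Ψ : K ⟶ K') (f : A ⟶ A') (g : B ⟶ B')
    (hf : f ≫ a'.hom = a.hom ≫ homologyMap Ψ.τ₁ j)
    (hg : g ≫ b'.hom = b.hom ≫ homologyMap Ψ.τ₃ i) :
    conjDelta hK hij a b ≫ f = g ≫ conjDelta hK' hij a' b' := by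
  rw [← cancel_mono a'.hom, Category.assoc, hf, ← Category.assoc, conjDelta_comp_hom,
    Category.assoc, HomologySequence.δ_naturality Ψ hK hK', Category.assoc, conjDelta_comp_hom,
    ← Category.assoc, ← Category.assoc, hg]

variable {g : M ⟶ B} {m : M ≅ K.X₂.homology i} (hg : g ≫ b.hom = m.hom ≫ homologyMap K.g i)

include hg in
lemma comp_conjDelta : g ≫ conjDelta hK hij a b = 0 := by
  rw [← cancel_mono a.hom, Category.assoc, conjDelta_comp_hom, ← Category.assoc, hg, Category.assoc,
    hK.comp_δ, comp_zero, zero_comp]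

lemma conjDelta_exact₃ : (ShortComplex.mk _ _ (comp_conjDelta hK hij a b hg)).Exact :=
  ShortComplex.exact_of_iso
    (ShortComplex.isoMk m b a hg.symm (conjDelta_comp_hom hK hij a b).symm).symm
    (hK.homology_exact₃ i j hij)

variable {f : A ⟶ M} {m : M ≅ K.X₂.homology j} (hf : f ≫ m.hom = a.hom ≫ homologyMap K.f j)

include hf in
lemma conjDelta_comp : conjDelta hK hij a b ≫ f = 0 := by
  rw [← cancel_mono m.hom, Category.assoc, hf, ← Category.assoc, conjDelta_comp_hom, Category.assoc,
    hK.δ_comp, comp_zero, zero_comp]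

lemma conjDelta_exact₁ : (ShortComplex.mk _ _ (conjDelta_comp hK hij a b hf)).Exact :=
  ShortComplex.exact_of_iso
    (ShortComplex.isoMk b a m (conjDelta_comp_hom hK hij a b).symm hf.symm).symm
    (hK.homology_exact₁ i j hij)

end ConjDelta

namespace ResolvedSequence

variable {S S' : ShortComplex C}

/-- The short exact sequence of complexes underlying a resolved sequence. -/
abbrev complexes (P : ResolvedSequence S) : ShortComplex (CochainComplex C ℕ) :=
  ShortComplex.mk P.f P.g P.zero

/- The comparison map of the middle resolutions commutes with `P.f` and `P'.f` up to a homotopy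
only; since `P.f` is degreewise mono, the homotopy extends to the middle resolution, and subtracting
the resulting null-homotopic map makes the square commute strictly. -/
lemma exists_lift_middle (P : ResolvedSequence S) (P' : ResolvedSequence S') (φ : S ⟶ S')
    (α : P.res₁.cocomplex ⟶ P'.res₁.cocomplex)
    (hα : P.res₁.ι ≫ α = (CochainComplex.single₀ C).map φ.τ₁ ≫ P'.res₁.ι) :
    ∃ β : P.res₂.cocomplex ⟶ P'.res₂.cocomplex, P.f ≫ β = α ≫ P'.f ∧
      P.res₂.ι ≫ β = (CochainComplex.single₀ C).map φ.τ₂ ≫ P'.res₂.ι := by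
  have : Mono P.f := P.shortExact.mono_f
  let β := InjectiveResolution.desc φ.τ₂ P'.res₂ P.res₂
  have hβ : P.res₂.ι ≫ β = (CochainComplex.single₀ C).map φ.τ₂ ≫ P'.res₂.ι :=
    InjectiveResolution.desc_commutes _ _ _
  let H : Homotopy (P.f ≫ β) (α ≫ P'.f) := InjectiveResolution.descHomotopy (S.f ≫ φ.τ₂) _ _
    (by rw [← Category.assoc, P.comm_f, Category.assoc, hβ, Functor.map_comp, Category.assoc])
    (by rw [← Category.assoc, hα, Category.assoc, P'.comm_f, ← Category.assoc,
      ← Functor.map_comp, φ.comm₁₂])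
  obtain ⟨k, hk⟩ := exists_comp_nullHomotopicMap_eq_sub P.f H
  refine ⟨β - Homotopy.nullHomotopicMap k, ?_, ?_⟩
  · rw [comp_sub, hk, sub_sub_cancel]
  · rw [comp_sub, ι_comp_nullHomotopicMap, sub_zero, hβ]

lemma ι_comp_eq_of_epi (P : ResolvedSequence S) (P' : ResolvedSequence S') (φ : S ⟶ S') [Epi S.g]
    {β : P.res₂.cocomplex ⟶ P'.res₂.cocomplex} {γ : P.res₃.cocomplex ⟶ P'.res₃.cocomplex}
    (hγ : P.g ≫ γ = β ≫ P'.g)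
    (hβ : P.res₂.ι ≫ β = (CochainComplex.single₀ C).map φ.τ₂ ≫ P'.res₂.ι) :
    P.res₃.ι ≫ γ = (CochainComplex.single₀ C).map φ.τ₃ ≫ P'.res₃.ι := by
  rw [← cancel_epi ((CochainComplex.single₀ C).map S.g)]
  calc (CochainComplex.single₀ C).map S.g ≫ P.res₃.ι ≫ γ
      = P.res₂.ι ≫ β ≫ P'.g := by rw [← Category.assoc, ← P.comm_g, Category.assoc, hγ]
    _ = (CochainComplex.single₀ C).map (φ.τ₂ ≫ S'.g) ≫ P'.res₃.ι := by
      rw [← Category.assoc, hβ, Category.assoc, P'.comm_g, ← Category.assoc, ← Functor.map_comp]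
    _ = (CochainComplex.single₀ C).map S.g ≫ (CochainComplex.single₀ C).map φ.τ₃ ≫ P'.res₃.ι := by
      rw [φ.comm₂₃, Functor.map_comp, Category.assoc]

lemma exists_complexes_map (hS : S.ShortExact) (P : ResolvedSequence S) (P' : ResolvedSequence S')
    (φ : S ⟶ S') :
    ∃ Ψ : P.complexes ⟶ P'.complexes,
      P.res₁.ι ≫ Ψ.τ₁ = (CochainComplex.single₀ C).map φ.τ₁ ≫ P'.res₁.ι ∧
      P.res₃.ι ≫ Ψ.τ₃ = (CochainComplex.single₀ C).map φ.τ₃ ≫ P'.res₃.ι := by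
  have := hS.epi_g
  have : Epi P.g := P.shortExact.epi_g
  let α := InjectiveResolution.desc φ.τ₁ P'.res₁ P.res₁
  have hα : P.res₁.ι ≫ α = (CochainComplex.single₀ C).map φ.τ₁ ≫ P'.res₁.ι :=
    InjectiveResolution.desc_commutes _ _ _
  obtain ⟨β, hβ, hβι⟩ := exists_lift_middle P P' φ α hα
  have hw : P.f ≫ β ≫ P'.g = 0 := by
    rw [← Category.assoc, hβ, Category.assoc, P'.zero, comp_zero]
  have hγ := P.shortExact.exact.g_desc (β ≫ P'.g) hw
  exact ⟨⟨α, β, P.shortExact.exact.desc (β ≫ P'.g) hw, hβ.symm, hγ.symm⟩, hα,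
    ι_comp_eq_of_epi P P' φ hγ hβι⟩

variable [EnoughInjectives C] (F : C ⥤ D) [F.Additive] (P : ResolvedSequence S)

lemma map_f_comp_iso (n : ℕ) :
    (F.rightDerived n).map S.f ≫ (rightDerivedObjIso F P.res₂ n).hom =
      (rightDerivedObjIso F P.res₁ n).hom ≫
        homologyMap ((F.mapHomologicalComplex _).map P.f) n :=
  rightDerived_map_comp_rightDerivedObjIso F _ _ _ _ P.comm_f n

lemma map_g_comp_iso (n : ℕ) :
    (F.rightDerived n).map S.g ≫ (rightDerivedObjIso F P.res₃ n).hom =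
      (rightDerivedObjIso F P.res₂ n).hom ≫
        homologyMap ((F.mapHomologicalComplex _).map P.g) n :=
  rightDerived_map_comp_rightDerivedObjIso F _ _ _ _ P.comm_g n

end ResolvedSequence

section LongExactSequence

open ResolvedSequence

variable [EnoughInjectives C] (F : C ⥤ D) [F.Additive] {S S' : ShortComplex C} (hS : S.ShortExact)
  (hS' : S'.ShortExact)

lemma rightDerivedDelta_naturality (φ : S ⟶ S') (n : ℕ) :
    rightDerivedDelta F hS n ≫ (F.rightDerived (n + 1)).map φ.τ₁ =
      (F.rightDerived n).map φ.τ₃ ≫ rightDerivedDelta F hS' n := by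
  obtain ⟨Ψ, h1, h3⟩ := exists_complexes_map hS (Horseshoe.exists_resolvedSequence hS).some
    (Horseshoe.exists_resolvedSequence hS').some φ
  exact conjDelta_naturality _ _ _ _ _ _ _
    ((F.mapHomologicalComplex (ComplexShape.up ℕ)).mapShortComplex.map Ψ) _ _
    (rightDerived_map_comp_rightDerivedObjIso F _ _ _ _ h1 (n + 1))
    (rightDerived_map_comp_rightDerivedObjIso F _ _ _ _ h3 n)

include hS in
lemma rightDerived_exact₂ (n : ℕ) : (S.map (F.rightDerived n)).Exact :=
  have P := (Horseshoe.exists_resolvedSequence hS).some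
  ShortComplex.exact_of_iso
    (ShortComplex.isoMk (rightDerivedObjIso F P.res₁ n) (rightDerivedObjIso F P.res₂ n)
      (rightDerivedObjIso F P.res₃ n) (P.map_f_comp_iso F n).symm (P.map_g_comp_iso F n).symm).symm
    ((P.map_shortExact F).homology_exact₂ n)

lemma map_comp_rightDerivedDelta (n : ℕ) :
    (F.rightDerived n).map S.g ≫ rightDerivedDelta F hS n = 0 :=
  let P := (Horseshoe.exists_resolvedSequence hS).some
  comp_conjDelta (P.map_shortExact F) rfl (rightDerivedObjIso F P.res₁ (n + 1))
    (rightDerivedObjIso F P.res₃ n) (P.map_g_comp_iso F n)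

lemma rightDerivedDelta_exact₃ (n : ℕ) :
    (ShortComplex.mk _ _ (map_comp_rightDerivedDelta F hS n)).Exact :=
  let P := (Horseshoe.exists_resolvedSequence hS).some
  conjDelta_exact₃ (P.map_shortExact F) rfl (rightDerivedObjIso F P.res₁ (n + 1))
    (rightDerivedObjIso F P.res₃ n) (P.map_g_comp_iso F n)

lemma rightDerivedDelta_comp_map (n : ℕ) :
    rightDerivedDelta F hS n ≫ (F.rightDerived (n + 1)).map S.f = 0 :=
  let P := (Horseshoe.exists_resolvedSequence hS).some
  conjDelta_comp (P.map_shortExact F) rfl (rightDerivedObjIso F P.res₁ (n + 1))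
    (rightDerivedObjIso F P.res₃ n) (P.map_f_comp_iso F (n + 1))

lemma rightDerivedDelta_exact₁ (n : ℕ) :
    (ShortComplex.mk _ _ (rightDerivedDelta_comp_map F hS n)).Exact :=
  let P := (Horseshoe.exists_resolvedSequence hS).some
  conjDelta_exact₁ (P.map_shortExact F) rfl (rightDerivedObjIso F P.res₁ (n + 1))
    (rightDerivedObjIso F P.res₃ n) (P.map_f_comp_iso F (n + 1))

include hS in
lemma mono_rightDerived_zero_map : Mono ((F.rightDerived 0).map S.f) := by
  let P := (Horseshoe.exists_resolvedSequence hS).some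
  have : Mono (((F.mapHomologicalComplex (ComplexShape.up ℕ)).map P.f).f 0) :=
    ((shortExact_iff_degreewise_shortExact _).1 (P.map_shortExact F) 0).mono_f
  have := mono_homologyMap_zero ((F.mapHomologicalComplex _).map P.f)
  have : Mono ((F.rightDerived 0).map S.f ≫ (rightDerivedObjIso F P.res₂ 0).hom) := by
    rw [P.map_f_comp_iso F 0]
    infer_instance
  exact mono_of_mono _ (rightDerivedObjIso F P.res₂ 0).hom

end LongExactSequence

end HomologicalAlgebra

section ExtSequences

variable {R : Type u} [Ring R] [TopologicalSpace R] [IsTopologicalRing R]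

lemma extPost_id (Z : PMod R) (A : DMod R) (n : ℕ) : extPost Z (𝟙 A) n = AddMonoidHom.id _ := by
  unfold extPost
  rw [CategoryTheory.Functor.map_id]
  rfl

lemma extPost_comp (Z : PMod R) {A B C : DMod R} (f : A ⟶ B) (g : B ⟶ C) (n : ℕ) :
    extPost Z (f ≫ g) n = (extPost Z g n).comp (extPost Z f n) := by
  unfold extPost
  rw [Functor.map_comp]
  rfl

lemma extPost_extPost (Z : PMod R) {A B C : DMod R} (f : A ⟶ B) (g : B ⟶ C) (n : ℕ)
    (a : ExtR Z A n) : extPost Z g n (extPost Z f n a) = extPost Z (f ≫ g) n a := by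
  rw [extPost_comp]
  rfl

instance (Z : PMod R) (n : ℕ) : (extFunctor Z n).Additive :=
  inferInstanceAs ((homFunctor Z).rightDerived n).Additive

lemma extPost_add (Z : PMod R) {A B : DMod R} (f g : A ⟶ B) (n : ℕ) :
    extPost Z (f + g) n = extPost Z f n + extPost Z g n := by
  unfold extPost
  rw [Functor.map_add]
  rfl

lemma extPost_zero (Z : PMod R) (A B : DMod R) (n : ℕ) :
    extPost Z (0 : A ⟶ B) n = 0 := by
  unfold extPost
  rw [Functor.map_zero]
  rfl

lemma extPre_id (Z : PMod R) (A : DMod R) (n : ℕ) : extPre (𝟙 Z) A n = AddMonoidHom.id _ := by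
  have h : homPrecomp (𝟙 Z) = 𝟙 (homFunctor Z) := rfl
  unfold extPre
  rw [h, NatTrans.rightDerived_id]
  rfl

lemma extPre_comp {Z Z' Z'' : PMod R} (f : Z'' ⟶ Z') (g : Z' ⟶ Z) (A : DMod R) (n : ℕ) :
    extPre (f ≫ g) A n = (extPre f A n).comp (extPre g A n) := by
  have h : homPrecomp (f ≫ g) = homPrecomp g ≫ homPrecomp f := rfl
  unfold extPre
  rw [h, NatTrans.rightDerived_comp]
  rfl

lemma extPost_extPre {Z' Z : PMod R} (ζ : Z' ⟶ Z) {A B : DMod R} (φ : A ⟶ B) (n : ℕ)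
    (a : ExtR Z A n) :
    extPost Z' φ n (extPre ζ A n a) = extPre ζ B n (extPost Z φ n a) :=
  (ConcreteCategory.congr_hom ((NatTrans.rightDerived (homPrecomp ζ) n).naturality φ) a).symm

section FirstArgument

variable (Z : PMod R) {S S' : ShortComplex (DMod R)} (hS : S.ShortExact) (hS' : S'.ShortExact)

lemma extPost_extDelta (φ : S ⟶ S') (n : ℕ) (t : ExtR Z S.X₃ n) :
    extPost Z φ.τ₁ (n + 1) (extDelta Z hS n t) = extDelta Z hS' n (extPost Z φ.τ₃ n t) :=
  ConcreteCategory.congr_hom (rightDerivedDelta_naturality (homFunctor Z) hS hS' φ n) t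

include hS in
lemma extPost_exact (n : ℕ) : Function.Exact (extPost Z S.f n) (extPost Z S.g n) :=
  (ShortComplex.ab_exact_iff_function_exact _).1 (rightDerived_exact₂ (homFunctor Z) hS n)

lemma extPost_extDelta_exact (n : ℕ) : Function.Exact (extPost Z S.g n) (extDelta Z hS n) :=
  (ShortComplex.ab_exact_iff_function_exact _).1 (rightDerivedDelta_exact₃ (homFunctor Z) hS n)

lemma extDelta_extPost_exact (n : ℕ) : Function.Exact (extDelta Z hS n) (extPost Z S.f (n + 1)) :=
  (ShortComplex.ab_exact_iff_function_exact _).1 (rightDerivedDelta_exact₁ (homFunctor Z) hS n)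

include hS in
lemma extPost_zero_injective : Function.Injective (extPost Z S.f 0) :=
  (AddCommGrpCat.mono_iff_injective _).1 (mono_rightDerived_zero_map (homFunctor Z) hS)

end FirstArgument

section SecondArgument

variable [CompactSpace R] {Z' Z Z'' : PMod R} {i : Z' ⟶ Z} {q : Z ⟶ Z''}
  (h : PMod.IsShortExact i q)

/-- The morphism of short exact sequences of complexes of homomorphisms that is induced by a
morphism of short exact sequences of profinite modules. -/
noncomputable def PMod.IsShortExact.complexesMap {W' W W'' : PMod R} {j : W' ⟶ W} {p : W ⟶ W''}
    (k : PMod.IsShortExact j p) {a : W'' ⟶ Z''} {b : W ⟶ Z} {c : W' ⟶ Z'}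
    (hc : j ≫ b = c ≫ i) (ha : p ≫ a = b ≫ q) (K : CochainComplex (DMod R) ℕ) :
    h.complexes K ⟶ k.complexes K where
  τ₁ := (NatTrans.mapHomologicalComplex (homPrecomp a) _).app K
  τ₂ := (NatTrans.mapHomologicalComplex (homPrecomp b) _).app K
  τ₃ := (NatTrans.mapHomologicalComplex (homPrecomp c) _).app K
  comm₁₂ := by
    ext m : 1
    exact congr_app (congrArg homPrecomp ha) (K.X m)
  comm₂₃ := by
    ext m : 1
    exact congr_app (congrArg homPrecomp hc) (K.X m)

lemma extPre_extDeltaPre {W' W W'' : PMod R} {j : W' ⟶ W} {p : W ⟶ W''}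
    (k : PMod.IsShortExact j p) (a : W'' ⟶ Z'') (b : W ⟶ Z) (c : W' ⟶ Z')
    (hc : j ≫ b = c ≫ i) (ha : p ≫ a = b ≫ q) (A : DMod R) (n : ℕ) (t : ExtR Z' A n) :
    extPre a A (n + 1) (extDeltaPre h A n t) = extDeltaPre k A n (extPre c A n t) := by
  let I := injectiveResolution A
  exact ConcreteCategory.congr_hom (conjDelta_naturality (h.complexes_shortExact I)
    (k.complexes_shortExact I) rfl _ _ _ _ (h.complexesMap k hc ha I.cocomplex) _ _
    (rightDerived_app_comp_rightDerivedObjIso (homFunctor Z'') (homPrecomp a) I (n + 1))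
    (rightDerived_app_comp_rightDerivedObjIso (homFunctor Z') (homPrecomp c) I n)) t

lemma extPost_extDeltaPre {A B : DMod R} (φ : A ⟶ B) (n : ℕ) (t : ExtR Z' A n) :
    extPost Z'' φ (n + 1) (extDeltaPre h A n t) = extDeltaPre h B n (extPost Z' φ n t) := by
  let I := injectiveResolution A
  let J := injectiveResolution B
  let d := InjectiveResolution.desc φ J I
  have hd := InjectiveResolution.desc_commutes φ J I
  let Ψ : h.complexes I.cocomplex ⟶ h.complexes J.cocomplex :=
    { τ₁ := ((homFunctor Z'').mapHomologicalComplex _).map d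
      τ₂ := ((homFunctor Z).mapHomologicalComplex _).map d
      τ₃ := ((homFunctor Z').mapHomologicalComplex _).map d
      comm₁₂ := (NatTrans.mapHomologicalComplex (homPrecomp q) _).naturality d
      comm₂₃ := (NatTrans.mapHomologicalComplex (homPrecomp i) _).naturality d }
  exact ConcreteCategory.congr_hom (conjDelta_naturality (h.complexes_shortExact I)
    (h.complexes_shortExact J) rfl _ _ _ _ Ψ _ _
    (rightDerived_map_comp_rightDerivedObjIso (homFunctor Z'') φ I J d hd (n + 1))
    (rightDerived_map_comp_rightDerivedObjIso (homFunctor Z') φ I J d hd n)) t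

include h in
lemma extPre_exact (A : DMod R) (n : ℕ) : Function.Exact (extPre q A n) (extPre i A n) := by
  let I := injectiveResolution A
  have hw : (NatTrans.rightDerived (homPrecomp q) n).app A ≫
      (NatTrans.rightDerived (homPrecomp i) n).app A = 0 := by
    have h0 : (NatTrans.mapHomologicalComplex (0 : homFunctor Z'' ⟶ homFunctor Z')
      (ComplexShape.up ℕ)).app I.cocomplex = 0 := rfl
    rw [← NatTrans.comp_app, ← NatTrans.rightDerived_comp, h.comp_eq_zero, I.rightDerived_app_eq,
      h0, Functor.map_zero, zero_comp, comp_zero]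
  exact (ShortComplex.ab_exact_iff_function_exact (ShortComplex.mk
    ((NatTrans.rightDerived (homPrecomp q) n).app A)
    ((NatTrans.rightDerived (homPrecomp i) n).app A) hw)).1
    (ShortComplex.exact_of_iso (ShortComplex.isoMk (rightDerivedObjIso (homFunctor Z'') I n)
      (rightDerivedObjIso (homFunctor Z) I n) (rightDerivedObjIso (homFunctor Z') I n)
      (rightDerived_app_comp_rightDerivedObjIso _ _ I n).symm
      (rightDerived_app_comp_rightDerivedObjIso _ _ I n).symm).symm
      ((h.complexes_shortExact I).homology_exact₂ n))

lemma extPre_extDeltaPre_exact (A : DMod R) (n : ℕ) :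
    Function.Exact (extPre i A n) (extDeltaPre h A n) :=
  (ShortComplex.ab_exact_iff_function_exact _).1
    (conjDelta_exact₃ (h.complexes_shortExact (injectiveResolution A)) rfl _ _
      (rightDerived_app_comp_rightDerivedObjIso (homFunctor Z) (homPrecomp i) _ n))

lemma extDeltaPre_extPre_exact (A : DMod R) (n : ℕ) :
    Function.Exact (extDeltaPre h A n) (extPre q A (n + 1)) :=
  (ShortComplex.ab_exact_iff_function_exact _).1
    (conjDelta_exact₁ (h.complexes_shortExact (injectiveResolution A)) rfl _ _
      (rightDerived_app_comp_rightDerivedObjIso (homFunctor Z'') (homPrecomp q) _ (n + 1)))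

include h in
lemma extPre_zero_injective (A : DMod R) : Function.Injective (extPre q A 0) := by
  let I := injectiveResolution A
  have hdegree : Mono (((NatTrans.mapHomologicalComplex (homPrecomp q)
      (ComplexShape.up ℕ)).app I.cocomplex).f 0) :=
    (h.hom_shortExact (I.cocomplex.X 0)).mono_f
  have := mono_homologyMap_zero
    ((NatTrans.mapHomologicalComplex (homPrecomp q) (ComplexShape.up ℕ)).app I.cocomplex)
  have hcomp : Mono ((NatTrans.rightDerived (homPrecomp q) 0).app A ≫
      (rightDerivedObjIso (homFunctor Z) I 0).hom) := by
    rw [rightDerived_app_comp_rightDerivedObjIso]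
    infer_instance
  exact (AddCommGrpCat.mono_iff_injective _).1
    (mono_of_mono _ (rightDerivedObjIso (homFunctor Z) I 0).hom)

end SecondArgument

end ExtSequences

section ElementwiseColimit

universe v w v' w'

variable {J : Type w} [Category.{v} J] {C : Type w'} [Category.{v'} C] {F : J ⥤ C}

/-- The functor `G` takes the cocone `c` to a filtered colimit of abelian groups, in terms of
elements. -/
structure IsElemColim (c : Cocone F) (G : C ⥤ AddCommGrpCat.{u}) : Prop where
  exists_rep : ∀ a : G.obj c.pt, ∃ (j : J) (m : G.obj (F.obj j)), G.map (c.ι.app j) m = a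
  exists_map_eq_zero : ∀ (j : J) (m : G.obj (F.obj j)), G.map (c.ι.app j) m = 0 →
    ∃ (k : J) (f : j ⟶ k), G.map (F.map f) m = 0

lemma map_cocone_w_apply (c : Cocone F) (G : C ⥤ AddCommGrpCat.{u}) {j k : J} (f : j ⟶ k)
    (m : G.obj (F.obj j)) : G.map (c.ι.app k) (G.map (F.map f) m) = G.map (c.ι.app j) m := by
  rw [← c.w f, G.map_comp]
  rfl

lemma map_map_apply (F : J ⥤ C) (G : C ⥤ AddCommGrpCat.{u}) {j k l : J} (f : j ⟶ k) (g : k ⟶ l)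
    (m : G.obj (F.obj j)) : G.map (F.map g) (G.map (F.map f) m) = G.map (F.map (f ≫ g)) m := by
  rw [F.map_comp, G.map_comp]
  rfl

namespace IsElemColim

variable {c : Cocone F} {G : C ⥤ AddCommGrpCat.{u}}

lemma exists_map_eq_zero_finite (h : IsElemColim c G) {j : J} {S : Set (G.obj (F.obj j))}
    (hS : S.Finite) (h0 : ∀ m ∈ S, G.map (c.ι.app j) m = 0) :
    ∃ (k : J) (f : j ⟶ k), ∀ m ∈ S, G.map (F.map f) m = 0 := by
  induction S, hS using Set.Finite.induction_on with
  | empty => exact ⟨j, 𝟙 j, by simp⟩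
  | @insert a S _ _ ih =>
    obtain ⟨k, f, hf⟩ := ih fun m hm => h0 m (Set.mem_insert_of_mem _ hm)
    obtain ⟨l, g, hg⟩ := h.exists_map_eq_zero k (G.map (F.map f) a)
      ((map_cocone_w_apply c G f a).trans (h0 a (Set.mem_insert _ _)))
    refine ⟨l, f ≫ g, ?_⟩
    rintro m (rfl | hm)
    · rw [← map_map_apply, hg]
    · rw [← map_map_apply, hf m hm, map_zero]

variable [IsFiltered J]

lemma exists_rep_finite (h : IsElemColim c G) {S : Set (G.obj c.pt)} (hS : S.Finite) :
    ∃ (j : J) (σ : G.obj c.pt → G.obj (F.obj j)), ∀ a ∈ S, G.map (c.ι.app j) (σ a) = a := by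
  classical
  induction S, hS using Set.Finite.induction_on with
  | empty => exact ⟨IsFiltered.nonempty.some, fun _ => 0, by simp⟩
  | @insert a S _ _ ih =>
    obtain ⟨j, σ, hσ⟩ := ih
    obtain ⟨k, m, hm⟩ := h.exists_rep a
    refine ⟨IsFiltered.max j k, Function.update
      (fun b => G.map (F.map (IsFiltered.leftToMax j k)) (σ b)) a
      (G.map (F.map (IsFiltered.rightToMax j k)) m), fun b hb => ?_⟩
    obtain rfl | hba := eq_or_ne b a
    · rw [Function.update_self, map_cocone_w_apply, hm]
    · rw [Function.update_of_ne hba, map_cocone_w_apply, hσ b (hb.resolve_left hba)]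

lemma of_exact_of_surjective {P Q T : C ⥤ AddCommGrpCat.{u}} (hP : IsElemColim c P)
    (hQ : IsElemColim c Q) (α : P ⟶ Q) (β : Q ⟶ T)
    (hαβ : ∀ A, Function.Exact (α.app A) (β.app A)) (hβ : ∀ A, Function.Surjective (β.app A)) :
    IsElemColim c T where
  exists_rep a := by
    obtain ⟨x, rfl⟩ := hβ _ a
    obtain ⟨j, y, rfl⟩ := hQ.exists_rep x
    exact ⟨j, β.app _ y, (NatTrans.naturality_apply β (c.ι.app j) y).symm⟩
  exists_map_eq_zero j m hm := by
    obtain ⟨x, rfl⟩ := hβ _ m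
    rw [← NatTrans.naturality_apply] at hm
    obtain ⟨p, hp⟩ := (hαβ _ _).1 hm
    obtain ⟨k, y, rfl⟩ := hP.exists_rep p
    let a := IsFiltered.leftToMax j k
    let b := IsFiltered.rightToMax j k
    have hab : Q.map (c.ι.app _) (Q.map (F.map a) x - Q.map (F.map b) (α.app _ y)) = 0 := by
      rw [map_sub, map_cocone_w_apply, map_cocone_w_apply, ← NatTrans.naturality_apply]
      exact sub_eq_zero.2 hp.symm
    obtain ⟨l, f, hf⟩ := hQ.exists_map_eq_zero _ _ hab
    refine ⟨l, a ≫ f, ?_⟩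
    rw [map_sub, sub_eq_zero, map_map_apply, map_map_apply, ← NatTrans.naturality_apply] at hf
    rw [← NatTrans.naturality_apply, hf, (hαβ _).apply_apply_eq_zero]

lemma of_iso {P Q : C ⥤ AddCommGrpCat.{u}} (h : IsElemColim c P) (e : P ≅ Q) :
    IsElemColim c Q :=
  h.of_exact_of_surjective h 0 e.hom
    (fun A => (ShortComplex.ab_exact_iff_function_exact (ShortComplex.mk (0 : P.obj A ⟶ P.obj A)
      (e.hom.app A) zero_comp)).1 ((ShortComplex.exact_iff_mono _ rfl).2 inferInstance))
    fun _ => (AddCommGrpCat.epi_iff_surjective _).1 inferInstance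

end IsElemColim

end ElementwiseColimit

section FreeCover

open TopologicalSpace

variable {R : Type u} [Ring R] [TopologicalSpace R]

lemma DMod.isLocallyConstant_smul (A : DMod R) {E : Type*} [TopologicalSpace E] {f : E → Rᵐᵒᵖ}
    {g : E → A.obj} (hf : Continuous f) (hg : IsLocallyConstant g) :
    IsLocallyConstant fun e => f e • g e := by
  let _ : TopologicalSpace A.obj := ⊥
  have : DiscreteTopology A.obj := ⟨rfl⟩
  have : ContinuousSMul Rᵐᵒᵖ A.obj := A.property
  exact (IsLocallyConstant.iff_continuous _).2 (hf.smul hg.continuous)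

/-- A closed submodule of a compact, Hausdorff and totally disconnected module, as a profinite
module. -/
def PMod.ofIsClosed {M : Type u} [AddCommGroup M] [Module Rᵐᵒᵖ M] [TopologicalSpace M]
    [IsTopologicalAddGroup M] [ContinuousSMul Rᵐᵒᵖ M] [CompactSpace M] [T2Space M]
    [TotallyDisconnectedSpace M] (N : Submodule Rᵐᵒᵖ M) (hN : IsClosed (N : Set M)) : PMod R :=
  ⟨TopModuleCat.of Rᵐᵒᵖ N, isCompact_iff_compactSpace.1 hN.isCompact,
    inferInstanceAs (T2Space N), inferInstanceAs (TotallyDisconnectedSpace N)⟩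

namespace PMod

/-- The kernel of a homomorphism of profinite modules. -/
def kernel {P Z : PMod R} (q : P ⟶ Z) : PMod R :=
  have := P.property.1
  have := P.property.2.1
  have := P.property.2.2
  have := Z.property.2.1
  ofIsClosed (LinearMap.ker q.hom.hom.toLinearMap)
    (isClosed_singleton.preimage q.hom.hom.continuous)

/-- The inclusion of the kernel of a homomorphism of profinite modules. -/
def kernelι {P Z : PMod R} (q : P ⟶ Z) : kernel q ⟶ P :=
  ObjectProperty.homMk (TopModuleCat.ofHom
    (Submodule.subtypeL (LinearMap.ker q.hom.hom.toLinearMap)))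

lemma isShortExact_kernelι {P Z : PMod R} {q : P ⟶ Z} (hq : Function.Surjective q.hom.hom) :
    IsShortExact (kernelι q) q where
  injective := Subtype.val_injective
  exact x := ⟨fun hx => ⟨⟨x, hx⟩, rfl⟩, by rintro ⟨y, rfl⟩; exact y.2⟩
  surjective := hq

/-- The Dirac element of `z`: its `U`-coordinate, for `U` clopen, is the mass that the Dirac measure
at `z` gives to `U`. The last coordinate keeps `z` itself. -/
noncomputable def dirac (Z : PMod R) (z : Z.obj) : (Clopens Z.obj → Rᵐᵒᵖ) × Z.obj :=
  (fun U => LocallyConstant.charFn Rᵐᵒᵖ U.isClopen z, z)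

lemma continuous_dirac (Z : PMod R) : Continuous Z.dirac :=
  (continuous_pi fun U => (LocallyConstant.charFn Rᵐᵒᵖ U.isClopen).continuous).prodMk continuous_id

variable [IsTopologicalRing R]

/-- The closed submodule of `R^(Clopens Z) × Z` generated by the Dirac elements. -/
noncomputable def diracSpan (Z : PMod R) : Submodule Rᵐᵒᵖ ((Clopens Z.obj → Rᵐᵒᵖ) × Z.obj) :=
  (Submodule.span Rᵐᵒᵖ (Set.range Z.dirac)).topologicalClosure

lemma dirac_mem_diracSpan (Z : PMod R) (z : Z.obj) : Z.dirac z ∈ Z.diracSpan :=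
  Submodule.le_topologicalClosure _ (Submodule.subset_span ⟨z, rfl⟩)

variable [CompactSpace R] [T2Space R] [TotallyDisconnectedSpace R]

/-- The submodule `diracSpan Z` as a profinite module: a free cover of `Z`, on which the group
`Hom(-, A)` is that of locally constant maps from `Z` to `A`. -/
noncomputable def freeCover (Z : PMod R) : PMod R :=
  have := Z.property.1
  have := Z.property.2.1
  have := Z.property.2.2
  have : CompactSpace Rᵐᵒᵖ := opHomeomorph.compactSpace
  have : TotallyDisconnectedSpace Rᵐᵒᵖ :=
    opHomeomorph.totallyDisconnectedSpace
  ofIsClosed Z.diracSpan (Submodule.isClosed_topologicalClosure _)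

/-- The projection of the free cover onto `Z`. -/
noncomputable def freeCoverπ (Z : PMod R) : Z.freeCover ⟶ Z :=
  ObjectProperty.homMk (TopModuleCat.ofHom
    ((ContinuousLinearMap.snd Rᵐᵒᵖ _ _).comp (Submodule.subtypeL Z.diracSpan)))

/-- The Dirac element of `z` in the free cover. -/
noncomputable def freeCoverDirac (Z : PMod R) : C(Z.obj, Z.freeCover.obj) :=
  ⟨fun z => ⟨Z.dirac z, Z.dirac_mem_diracSpan z⟩, Z.continuous_dirac.subtype_mk _⟩

lemma freeCoverπ_surjective (Z : PMod R) : Function.Surjective Z.freeCoverπ.hom.hom :=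
  fun z => ⟨Z.freeCoverDirac z, rfl⟩

lemma contHom_freeCover_ext {Z : PMod R} {A : DMod R} {f g : contHom Z.freeCover A}
    (h : ∀ z, f.1 (Z.freeCoverDirac z) = g.1 (Z.freeCoverDirac z)) : f = g := by
  let L : Submodule Rᵐᵒᵖ Z.diracSpan := LinearMap.eqLocus f.1 g.1
  have hL : IsClosed (L : Set Z.diracSpan) :=
    ⟨(f.2.prodMk g.2) {a : A.obj × A.obj | a.1 ≠ a.2}⟩
  have hle : Z.diracSpan ≤ L.map (Submodule.subtype _) := by
    refine Submodule.topologicalClosure_minimal _ (Submodule.span_le.2 ?_) ?_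
    · rintro _ ⟨z, rfl⟩
      exact ⟨Z.freeCoverDirac z, h z, rfl⟩
    · exact (Submodule.isClosed_topologicalClosure _).isClosedEmbedding_subtypeVal.isClosedMap _ hL
  refine Subtype.ext (LinearMap.ext fun x => ?_)
  obtain ⟨y, hy, hyx⟩ := hle x.2
  rwa [← Subtype.ext hyx]

/-- The homomorphism integrates `f` against the measures in the free cover. -/
lemma exists_contHom_freeCover {Z : PMod R} {A : DMod R} {f : Z.obj → A.obj}
    (hf : IsLocallyConstant f) :
    ∃ ψ : contHom Z.freeCover A, ∀ z, ψ.1 (Z.freeCoverDirac z) = f z := by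
  classical
  have := Z.property.1
  let s := hf.range_finite.toFinset
  let U (a : A.obj) : Clopens Z.obj := ⟨f ⁻¹' {a}, hf.isClopen_fiber a⟩
  let coord (a : A.obj) : Z.diracSpan →ₗ[Rᵐᵒᵖ] Rᵐᵒᵖ :=
    LinearMap.proj (U a) ∘ₗ LinearMap.fst Rᵐᵒᵖ _ Z.obj ∘ₗ Submodule.subtype _
  have hcoord (a) : Continuous (coord a) :=
    ((continuous_apply (U a)).comp continuous_fst).comp continuous_subtype_val
  let ψ : Z.diracSpan →ₗ[Rᵐᵒᵖ] A.obj :=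
    ∑ a ∈ s, (LinearMap.toSpanSingleton Rᵐᵒᵖ A.obj a).comp (coord a)
  have hψ (e) : ψ e = ∑ a ∈ s, coord a e • a := by simp [ψ]
  refine ⟨⟨ψ, ?_⟩, fun z => ?_⟩
  · change IsLocallyConstant ψ
    have hsum : ⇑ψ = ∑ a ∈ s, fun e => coord a e • a :=
      funext fun e => by rw [hψ, Finset.sum_apply]
    rw [hsum]
    exact Finset.sum_induction _ IsLocallyConstant (fun _ _ hf hg => hf.add hg)
      (IsLocallyConstant.const (0 : A.obj))
      fun a _ => A.isLocallyConstant_smul (hcoord a) (.const a)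
  · have hz (a : A.obj) : coord a (Z.freeCoverDirac z) = if f z = a then 1 else 0 :=
      Set.indicator_apply _ _ _
    refine (hψ _).trans ?_
    simp only [hz, ite_smul, one_smul, zero_smul, Finset.sum_ite_eq, ite_eq_left_iff]
    exact fun h => (h (hf.range_finite.mem_toFinset.2 ⟨z, rfl⟩)).elim

instance (Z : PMod R) : (homFunctor Z.freeCover).PreservesEpimorphisms where
  preserves {A B} g _ := by
    refine (AddCommGrpCat.epi_iff_surjective _).2 fun (φ : contHom Z.freeCover B) => ?_
    have hg : Function.Surjective g.hom.hom :=
      (ModuleCat.epi_iff_surjective g.hom).1 (inferInstanceAs (Epi ((IsDiscreteMod R).ι.map g)))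
    have hφ : IsLocallyConstant (Function.surjInv hg ∘ φ.1 ∘ Z.freeCoverDirac) :=
      (φ.2.comp_continuous Z.freeCoverDirac.continuous).comp _
    obtain ⟨ψ, hψ⟩ := exists_contHom_freeCover hφ
    exact ⟨ψ, contHom_freeCover_ext fun z => (congrArg _ (hψ z)).trans (Function.surjInv_eq hg _)⟩

end PMod

end FreeCover

section ExtColimit

variable {R : Type u} [Ring R] [TopologicalSpace R]

lemma exists_contHom_factor {Z : PMod R} {A B : DMod R} {i : A ⟶ B}
    (hi : Function.Injective i.hom.hom) (f : contHom Z B)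
    (hf : ∀ z, f.1 z ∈ LinearMap.range i.hom.hom) :
    ∃ g : contHom Z A, (homFunctor Z).map i g = f := by
  let e := LinearEquiv.ofInjective i.hom.hom hi
  let g : Z.obj →ₗ[Rᵐᵒᵖ] A.obj := e.symm.toLinearMap ∘ₗ f.1.codRestrict _ hf
  have hg (z) : i.hom.hom (g z) = f.1 z := congrArg Subtype.val (e.apply_symm_apply ⟨f.1 z, hf z⟩)
  have hgf : ⇑i.hom.hom ∘ ⇑g = ⇑f.1 := funext hg
  exact ⟨⟨g, .desc _ i.hom.hom (hgf ▸ f.2) hi⟩, Subtype.ext (LinearMap.ext hg)⟩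

lemma isAddTorsion_contHom (Z : PMod R) (A : DMod R) : IsAddTorsion (contHom Z A) := by
  intro f
  have := Z.property.1
  have : Finite f.1.toAddMonoidHom.range := f.2.range_finite
  refine isOfFinAddOrder_iff_nsmul_eq_zero.2
    ⟨Nat.card f.1.toAddMonoidHom.range, Nat.card_pos, Subtype.ext (LinearMap.ext fun z => ?_)⟩
  let y : f.1.toAddMonoidHom.range := ⟨f.1 z, z, rfl⟩
  exact congrArg Subtype.val (card_nsmul_eq_zero' (x := y))

variable (R) in
/-- The forgetful functor from discrete modules to abelian groups. -/
def toAb : DMod R ⥤ AddCommGrpCat.{u} where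
  obj A := AddCommGrpCat.of A.obj
  map f := AddCommGrpCat.ofHom f.hom.hom.toAddMonoidHom

namespace IsElemColim

universe v w

variable [CompactSpace R] {J : Type w} [Category.{v} J] [IsFiltered J] {F : J ⥤ DMod R}
  {c : Cocone F}

lemma exists_homFunctor_map_eq (h : IsElemColim c (toAb R)) {Z : PMod R}
    (f : contHom Z c.pt) :
    ∃ (j : J) (g : contHom Z (F.obj j)), (homFunctor Z).map (c.ι.app j) g = f := by
  have := Z.property.1
  have : CompactSpace Rᵐᵒᵖ := opHomeomorph.compactSpace
  obtain ⟨j, σ, hσ⟩ := h.exists_rep_finite f.2.range_finite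
  let σf (z : Z.obj) : (F.obj j).obj := σ (f.1 z)
  have hσf (z) : (c.ι.app j).hom.hom (σf z) = f.1 z := hσ _ ⟨z, rfl⟩
  have hlc : IsLocallyConstant σf := f.2.comp σ
  let addDefect (p : Z.obj × Z.obj) : (F.obj j).obj := σf (p.1 + p.2) - (σf p.1 + σf p.2)
  let smulDefect (p : Rᵐᵒᵖ × Z.obj) : (F.obj j).obj := σf (p.1 • p.2) - p.1 • σf p.2
  have hadd : IsLocallyConstant addDefect :=
    (hlc.comp_continuous continuous_add).sub
      ((hlc.comp_continuous continuous_fst).add (hlc.comp_continuous continuous_snd))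
  have hsmul : IsLocallyConstant smulDefect :=
    (hlc.comp_continuous continuous_smul).sub
      ((F.obj j).isLocallyConstant_smul continuous_fst (hlc.comp_continuous continuous_snd))
  obtain ⟨k, φ, hφ⟩ := h.exists_map_eq_zero_finite (j := j)
    (hadd.range_finite.union hsmul.range_finite) (by
      rintro _ (⟨p, rfl⟩ | ⟨p, rfl⟩)
      · change (c.ι.app j).hom.hom (_ - (_ + _)) = 0
        rw [map_sub, map_add, hσf, hσf, hσf, map_add, sub_self]
      · change (c.ι.app j).hom.hom (_ - _ • _) = 0
        rw [map_sub, map_smul, hσf, hσf, map_smul, sub_self])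
  let g : Z.obj →ₗ[Rᵐᵒᵖ] (F.obj k).obj :=
    { toFun z := (F.map φ).hom.hom (σf z)
      map_add' z w := by
        rw [← map_add, ← sub_eq_zero, ← map_sub]
        exact hφ _ (.inl ⟨(z, w), rfl⟩)
      map_smul' r z := by
        rw [RingHom.id_apply, ← map_smul, ← sub_eq_zero, ← map_sub]
        exact hφ _ (.inr ⟨(r, z), rfl⟩) }
  exact ⟨k, ⟨g, hlc.comp _⟩, Subtype.ext (LinearMap.ext fun z =>
    (map_cocone_w_apply c (toAb R) φ (σf z)).trans (hσf z))⟩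

lemma comp_homFunctor (h : IsElemColim c (toAb R)) (Z : PMod R) :
    IsElemColim c (homFunctor Z) where
  exists_rep f := h.exists_homFunctor_map_eq f
  exists_map_eq_zero j (m : contHom Z (F.obj j)) hm := by
    have := Z.property.1
    obtain ⟨k, φ, hφ⟩ := h.exists_map_eq_zero_finite (j := j) m.2.range_finite (by
      rintro _ ⟨z, rfl⟩
      exact congrArg (fun f : contHom Z c.pt => f.1 z) hm)
    exact ⟨k, φ, Subtype.ext (LinearMap.ext fun z => hφ _ ⟨z, rfl⟩)⟩

end IsElemColim

variable [IsTopologicalRing R]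

lemma DMod.injective_of_mono {A B : DMod R} (i : A ⟶ B) [Mono i] :
    Function.Injective i.hom.hom :=
  (ModuleCat.mono_iff_injective i.hom).1 (inferInstanceAs (Mono ((IsDiscreteMod R).ι.map i)))

lemma DMod.exact_of_shortComplex_exact {S : ShortComplex (DMod R)} (hS : S.Exact) :
    Function.Exact S.f.hom.hom S.g.hom.hom := by
  have (A B : DMod R) (f : A ⟶ B) : PreservesLimit (parallelPair f 0) (IsDiscreteMod R).ι :=
    (IsDiscreteMod R).preservesKernels_ι f
  have (A B : DMod R) (f : A ⟶ B) : PreservesColimit (parallelPair f 0) (IsDiscreteMod R).ι :=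
    (IsDiscreteMod R).preservesCokernels_ι f
  have : (IsDiscreteMod R).ι.PreservesHomology := { }
  exact (ShortComplex.ShortExact.moduleCat_exact_iff_function_exact _).1
    ((ShortComplex.exact_map_iff_of_faithful S (IsDiscreteMod R).ι).2 hS)

instance (Z : PMod R) : PreservesFiniteLimits (homFunctor Z) := by
  refine ((homFunctor Z).preservesFiniteLimits_tfae.out 0 3).1 fun S hS => ?_
  have := hS.mono_f
  have hf := DMod.injective_of_mono S.f
  refine ⟨(ShortComplex.ab_exact_iff _).2 fun (f : contHom Z S.X₂) hf0 => ?_,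
    (AddCommGrpCat.mono_iff_injective _).2 fun f g hfg => ?_⟩
  · exact exists_contHom_factor hf f fun z =>
      (DMod.exact_of_shortComplex_exact hS.exact _).1
        (congrArg (fun k : contHom Z S.X₃ => k.1 z) hf0)
  · exact Subtype.ext (LinearMap.ext fun z =>
      hf (congrArg (fun k : contHom Z S.X₂ => k.1 z) hfg))

/-- `Ext⁰` is `Hom`. -/
noncomputable def homIsoExtZero (Z : PMod R) : homFunctor Z ≅ extFunctor Z 0 :=
  (homFunctor Z).rightDerivedZeroIsoSelf.symm

section FreeCover

variable [CompactSpace R] [T2Space R] [TotallyDisconnectedSpace R]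

instance (Z : PMod R) (A : DMod R) (n : ℕ) : Subsingleton (ExtR Z.freeCover A (n + 1)) :=
  AddCommGrpCat.subsingleton_of_isZero (isZero_rightDerived_obj_succ (homFunctor Z.freeCover) n A)

lemma PMod.isShortExact_freeCover (Z : PMod R) :
    PMod.IsShortExact (kernelι Z.freeCoverπ) Z.freeCoverπ :=
  isShortExact_kernelι Z.freeCoverπ_surjective

lemma extDeltaPre_freeCover_surjective (Z : PMod R) (A : DMod R) (n : ℕ) :
    Function.Surjective (extDeltaPre Z.isShortExact_freeCover A n) := fun a =>
  (extDeltaPre_extPre_exact Z.isShortExact_freeCover A n a).1 (Subsingleton.elim _ _)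

lemma isAddTorsion_extR (Z : PMod R) (A : DMod R) (n : ℕ) : IsAddTorsion (ExtR Z A n) := by
  induction n generalizing Z with
  | zero =>
    have hs : Function.Surjective ((homIsoExtZero Z).hom.app A) :=
      (AddCommGrpCat.epi_iff_surjective _).1 inferInstance
    exact (isAddTorsion_contHom Z A).of_surjective (f := ((homIsoExtZero Z).hom.app A).hom) hs
  | succ n ih => exact (ih _).of_surjective (extDeltaPre_freeCover_surjective Z A n)

end FreeCover

lemma IsElemColim.comp_extFunctor [CompactSpace R] [T2Space R] [TotallyDisconnectedSpace R]
    {J : Type*} [Category* J] [IsFiltered J] {F : J ⥤ DMod R} {c : Cocone F}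
    (h : IsElemColim c (toAb R)) (Z : PMod R) (n : ℕ) : IsElemColim c (extFunctor Z n) := by
  induction n generalizing Z with
  | zero => exact (h.comp_homFunctor Z).of_iso (homIsoExtZero Z)
  | succ n ih =>
    have hZ := Z.isShortExact_freeCover
    let ι : extFunctor Z.freeCover n ⟶ extFunctor (PMod.kernel Z.freeCoverπ) n :=
      NatTrans.rightDerived (homPrecomp (PMod.kernelι Z.freeCoverπ)) n
    let δ : extFunctor (PMod.kernel Z.freeCoverπ) n ⟶ extFunctor Z (n + 1) :=
      { app A := AddCommGrpCat.ofHom (extDeltaPre hZ A n)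
        naturality _ _ φ := AddCommGrpCat.hom_ext (AddMonoidHom.ext fun t =>
          (extPost_extDeltaPre hZ φ n t).symm) }
    exact (ih _).of_exact_of_surjective (ih _) ι δ (fun A => extPre_extDeltaPre_exact hZ A n)
      fun A => extDeltaPre_freeCover_surjective Z A n

end ExtColimit

section Germs

open TopologicalSpace Topology

lemma clopens_top_of_local {X : Type*} [TopologicalSpace X] [CompactSpace X]
    {p : Clopens X → Prop} (bot : p ⊥) (sup : ∀ U V, p U → p V → p (U ⊔ V))
    (mem : ∀ x, ∃ U : Clopens X, x ∈ U ∧ p U) : p ⊤ := by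
  choose U hxU hU using mem
  obtain ⟨t, ht⟩ := CompactSpace.elim_nhds_subcover (fun x => (U x : Set X))
    fun x => (U x).isOpen.mem_nhds (hxU x)
  have hsup : t.sup U = ⊤ := top_unique fun x _ => by
    obtain ⟨y, hy, hxy⟩ := Set.mem_iUnion₂.1 (ht.ge (Set.mem_univ x))
    exact Finset.le_sup (f := U) hy hxy
  exact hsup ▸ Finset.sup_induction bot (fun V hV W hW => sup V W hV hW) fun x _ => hU x

lemma exists_clopens_of_eventually {X : Profinite.{u}} {x : X} {p : X → Prop}
    (h : ∀ᶠ y in 𝓝 x, p y) : ∃ U : Clopens X, x ∈ U ∧ ∀ y ∈ U, p y := by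
  obtain ⟨V, hV, hVo, hxV⟩ := mem_nhds_iff.1 h
  obtain ⟨U, hU, hxU, hUV⟩ := compact_exists_isClopen_in_isOpen hVo hxV
  exact ⟨⟨U, hU⟩, hxU, fun y hy => hV (hUV hy)⟩

/-- An abelian group `M` with an action `proj` of the Boolean algebra of clopen sets of a profinite
space `X` and quotients `ev x : M → G x` which are its stalks. It is the data that make the disjoint
union of the `G x` an étale space whose group of global sections is `M`. -/
structure GermData (X : Profinite.{u}) (G : X → Type u) [∀ x, AddCommGroup (G x)]
    (M : Type u) [AddCommGroup M] where
  ev : ∀ x, M →+ G x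
  proj : Clopens X → M →+ M
  ev_surjective : ∀ x, Function.Surjective (ev x)
  exists_proj_eq_zero : ∀ x a, ev x a = 0 → ∃ U : Clopens X, x ∈ U ∧ proj U a = 0
  ev_proj_of_mem : ∀ (x : X) (U : Clopens X) (a : M), x ∈ U → ev x (proj U a) = ev x a
  ev_proj_of_notMem : ∀ (x : X) (U : Clopens X) (a : M), x ∉ U → ev x (proj U a) = 0
  proj_top : ∀ a, proj ⊤ a = a
  proj_sup : ∀ (U V : Clopens X) (a : M), Disjoint U V → proj (U ⊔ V) a = proj U a + proj V a
  proj_proj_of_le : ∀ (U V : Clopens X) (a : M), U ≤ V → proj U (proj V a) = proj U a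

namespace GermData

variable {X : Profinite.{u}} {G : X → Type u} [∀ x, AddCommGroup (G x)]
    {M : Type u} [AddCommGroup M] (D : GermData X G M)

/-- The set of germs of an element of `M` at the points of a clopen set. -/
def germs (U : Clopens X) (a : M) : Set (Tot G) := {t | t.base ∈ U ∧ t.val = D.ev t.base a}

/-- The topology on the disjoint union of the stalks generated by the sets of germs. -/
@[reducible] def top : TopologicalSpace (Tot G) :=
  .generateFrom {O | ∃ (U : Clopens X) (a : M), O = D.germs U a}

lemma isOpen_germs (U : Clopens X) (a : M) : IsOpen[D.top] (D.germs U a) :=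
  .basic _ ⟨U, a, rfl⟩

lemma exists_ev_eq_of_ev_eq {x : X} {a b : M} (h : D.ev x a = D.ev x b) :
    ∃ U : Clopens X, x ∈ U ∧ ∀ y ∈ U, D.ev y a = D.ev y b := by
  obtain ⟨U, hxU, hU⟩ := D.exists_proj_eq_zero x (a - b) (by rw [map_sub, h, sub_self])
  refine ⟨U, hxU, fun y hy => ?_⟩
  rw [← sub_eq_zero, ← map_sub, ← D.ev_proj_of_mem y U _ hy, hU, map_zero]

lemma continuous_base : Continuous[D.top, inferInstance] (Tot.base : Tot G → X) := by
  let _ := D.top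
  refine (isTopologicalBasis_isClopen (X := X)).continuous_iff.2 fun U hU => ?_
  have h : Tot.base ⁻¹' U = ⋃ a, D.germs ⟨U, hU⟩ a := by
    ext t
    obtain ⟨a, ha⟩ := D.ev_surjective t.base t.val
    rw [Set.mem_iUnion]
    exact ⟨fun ht => ⟨a, ht, ha.symm⟩, fun ⟨_, ht, _⟩ => ht⟩
  rw [h]
  exact isOpen_iUnion fun a => D.isOpen_germs _ a

section Continuity

variable {T : Type*} [TopologicalSpace T] {σ : T → Tot G} {t₀ : T}

lemma continuousAt_of_eventually (hb : ContinuousAt (fun t => (σ t).base) t₀) (a : M)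
    (h : ∀ᶠ t in 𝓝 t₀, (σ t).val = D.ev (σ t).base a) : @ContinuousAt _ _ _ D.top σ t₀ := by
  refine tendsto_nhds_generateFrom_iff.2 ?_
  rintro _ ⟨U, b, rfl⟩ ⟨hU, hval⟩
  obtain ⟨W, hxW, hW⟩ := D.exists_ev_eq_of_ev_eq (h.self_of_nhds.symm.trans hval)
  filter_upwards [h, hb (W.isOpen.mem_nhds hxW), hb (U.isOpen.mem_nhds hU)] with t ht htW htU
  exact ⟨htU, ht.trans (hW _ htW)⟩

lemma eventually_val_eq (hσ : @ContinuousAt _ _ _ D.top σ t₀) {a : M}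
    (ha : D.ev (σ t₀).base a = (σ t₀).val) : ∀ᶠ t in 𝓝 t₀, (σ t).val = D.ev (σ t).base a := by
  let _ := D.top
  filter_upwards [hσ ((D.isOpen_germs ⊤ a).mem_nhds ⟨trivial, ha.symm⟩)] with t ht
  exact ht.2

end Continuity

lemma continuous_ev (a : M) : Continuous[inferInstance, D.top]
    fun x : X => (⟨x, D.ev x a⟩ : Tot G) := by
  let _ := D.top
  exact continuous_iff_continuousAt.2 fun x =>
    D.continuousAt_of_eventually continuousAt_id a (.of_forall fun _ => rfl)

lemma isLocalHomeomorph : @IsLocalHomeomorph _ _ D.top _ (Tot.base : Tot G → X) := by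
  let _ := D.top
  intro t
  obtain ⟨a, ha⟩ := D.ev_surjective t.base t.val
  exact ⟨{ toFun := Tot.base
           invFun := fun x => ⟨x, D.ev x a⟩
           source := D.germs ⊤ a
           target := Set.univ
           map_source' := fun _ _ => trivial
           map_target' := fun _ _ => ⟨trivial, rfl⟩
           left_inv' := fun s hs => Tot.ext rfl (heq_of_eq hs.2.symm)
           right_inv' := fun _ _ => rfl
           open_source := D.isOpen_germs ⊤ a
           open_target := isOpen_univ
           continuousOn_toFun := D.continuous_base.continuousOn
           continuousOn_invFun := (D.continuous_ev a).continuousOn }, ⟨trivial, ha.symm⟩, rfl⟩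

lemma continuous_add : Continuous[pairTop G D.top, D.top]
    fun t : Tot fun x => G x × G x => (⟨t.base, t.val.1 + t.val.2⟩ : Tot G) := by
  let _ := D.top
  let _ := pairTop G D.top
  have hpair : Continuous fun t : Tot fun x => G x × G x =>
      ((⟨t.base, t.val.1⟩, ⟨t.base, t.val.2⟩) : Tot G × Tot G) := continuous_induced_dom
  have hfst := continuous_fst.comp hpair
  have hsnd := continuous_snd.comp hpair
  refine continuous_iff_continuousAt.2 fun t => ?_
  obtain ⟨a, ha⟩ := D.ev_surjective t.base t.val.1
  obtain ⟨b, hb⟩ := D.ev_surjective t.base t.val.2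
  refine D.continuousAt_of_eventually (D.continuous_base.comp hfst).continuousAt (a + b) ?_
  filter_upwards [D.eventually_val_eq hfst.continuousAt ha,
    D.eventually_val_eq hsnd.continuousAt hb] with s hsa hsb
  exact (congrArg₂ (fun g g' : G s.base => g + g') hsa hsb).trans (map_add _ a b).symm

lemma continuous_neg : Continuous[D.top, D.top]
    fun t : Tot G => (⟨t.base, -t.val⟩ : Tot G) := by
  let _ := D.top
  refine continuous_iff_continuousAt.2 fun t => ?_
  obtain ⟨a, ha⟩ := D.ev_surjective t.base t.val
  refine D.continuousAt_of_eventually D.continuous_base.continuousAt (-a) ?_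
  filter_upwards [D.eventually_val_eq continuousAt_id ha] with s hs
  exact (congrArg Neg.neg hs).trans (map_neg _ _).symm

lemma isEtaleTorsion (h : ∀ x, IsAddTorsion (G x)) : IsEtaleTorsion G D.top where
  isLocalHomeomorph := D.isLocalHomeomorph
  continuous_zero := by simpa only [map_zero] using D.continuous_ev 0
  continuous_add := D.continuous_add
  continuous_neg := D.continuous_neg
  torsion := h

lemma proj_bot (a : M) : D.proj ⊥ a = 0 := by
  have h := D.proj_sup ⊥ ⊥ a disjoint_bot_left
  rw [sup_idem] at h
  exact left_eq_add.1 h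

lemma proj_sup_eq_zero {U V : Clopens X} {a : M} (hU : D.proj U a = 0) (hV : D.proj V a = 0) :
    D.proj (U ⊔ V) a = 0 := by
  rw [← sup_sdiff_self_right, D.proj_sup _ _ _ disjoint_sdiff_self_right, hU,
    ← D.proj_proj_of_le (V \ U) V a sdiff_le, hV, map_zero, add_zero]

lemma eq_zero_of_ev_eq_zero {a : M} (h : ∀ x, D.ev x a = 0) : a = 0 := by
  have htop : D.proj ⊤ a = 0 := clopens_top_of_local (p := fun U => D.proj U a = 0) (D.proj_bot a)
    (fun _ _ => D.proj_sup_eq_zero) fun x => D.exists_proj_eq_zero x a (h x)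
  rwa [D.proj_top] at htop

lemma ev_proj_add_proj_compl {U V : Clopens X} {s : ∀ x, G x} {a b : M}
    (ha : ∀ x ∈ U, D.ev x a = s x) (hb : ∀ x ∈ V, D.ev x b = s x) {x : X} (hx : x ∈ U ⊔ V) :
    D.ev x (D.proj U a + D.proj Uᶜ b) = s x := by
  rw [map_add]
  by_cases hxU : x ∈ U
  · rw [D.ev_proj_of_mem _ _ _ hxU, D.ev_proj_of_notMem _ _ _ (not_not_intro hxU), add_zero,
      ha x hxU]
  · rw [D.ev_proj_of_notMem _ _ _ hxU, D.ev_proj_of_mem _ _ _ hxU, zero_add,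
      hb x (hx.resolve_left hxU)]

lemma exists_ev_eq {s : ∀ x, G x}
    (hs : Continuous[inferInstance, D.top] fun x => (⟨x, s x⟩ : Tot G)) :
    ∃ a, ∀ x, D.ev x a = s x := by
  let _ := D.top
  suffices ∃ a, ∀ x ∈ (⊤ : Clopens X), D.ev x a = s x from this.imp fun _ ha x => ha x trivial
  refine clopens_top_of_local (p := fun U => ∃ a, ∀ x ∈ U, D.ev x a = s x)
    ⟨0, fun _ hx => hx.elim⟩ ?_ fun x => ?_
  · rintro U V ⟨a, ha⟩ ⟨b, hb⟩
    exact ⟨_, fun x hx => D.ev_proj_add_proj_compl ha hb hx⟩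
  · obtain ⟨a, ha⟩ := D.ev_surjective x (s x)
    obtain ⟨U, hxU, hU⟩ := exists_clopens_of_eventually
      (D.eventually_val_eq (σ := fun x => ⟨x, s x⟩) hs.continuousAt ha)
    exact ⟨U, hxU, a, fun y hy => (hU y hy).symm⟩

/-- The isomorphism of `M` with the group of global sections. The topology `τ` is only required to
be propositionally equal to `D.top`, so as to apply to topologies given by other generators. -/
noncomputable def cprodEquiv {τ : TopologicalSpace (Tot G)} (hτ : τ = D.top)
    (h : IsEtaleTorsion G τ) : M ≃+ h.cprod :=
  AddEquiv.ofBijective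
    (AddMonoidHom.mk' (fun a => (⟨fun x => D.ev x a, hτ ▸ D.continuous_ev a⟩ : h.cprod))
      fun a b => Subtype.ext (funext fun x => map_add (D.ev x) a b))
    ⟨(injective_iff_map_eq_zero _).2 fun _ ha => D.eq_zero_of_ev_eq_zero fun x =>
        congrFun (congrArg Subtype.val ha) x,
      fun s => by
        obtain ⟨a, ha⟩ := D.exists_ev_eq (s := s.1) (by rw [← hτ]; exact s.2)
        exact ⟨a, Subtype.ext (funext ha)⟩⟩

end GermData

end Germs

section EtaleStalks

open TopologicalSpace Topology

variable {R : Type u} [Ring R] [TopologicalSpace R] {X : Profinite.{u}}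

namespace EtaleMod

variable (𝒜 : EtaleMod R X)

open Classical in
/-- Extension by zero of families of elements of the fibres over a clopen set. -/
noncomputable def zeroExt (U : Clopens X) : (∀ y : U, 𝒜.Fam y) →ₗ[Rᵐᵒᵖ] ∀ x, 𝒜.Fam x :=
  LinearMap.pi fun x => if h : x ∈ U then LinearMap.proj (⟨x, h⟩ : U) else 0

variable {𝒜} in
lemma zeroExt_of_mem {U : Clopens X} (s : ∀ y : U, 𝒜.Fam y) {x : X} (h : x ∈ U) :
    𝒜.zeroExt U s x = s ⟨x, h⟩ := by
  rw [zeroExt, LinearMap.pi_apply, dif_pos h, LinearMap.proj_apply]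

variable {𝒜} in
lemma zeroExt_of_notMem {U : Clopens X} (s : ∀ y : U, 𝒜.Fam y) {x : X} (h : x ∉ U) :
    𝒜.zeroExt U s x = 0 := by
  rw [zeroExt, LinearMap.pi_apply, dif_neg h, LinearMap.zero_apply]

lemma continuous_zeroExt {U : Clopens X} {s : ∀ y : U, 𝒜.Fam y}
    (hs : Continuous fun y : U => (⟨y, s y⟩ : Tot 𝒜.Fam)) :
    Continuous fun x => (⟨x, 𝒜.zeroExt U s x⟩ : Tot 𝒜.Fam) := by
  refine continuous_iff_continuousAt.2 fun x => ?_
  by_cases hx : x ∈ U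
  · refine (U.isOpen.isOpenEmbedding_subtypeVal.continuousAt_iff (x := (⟨x, hx⟩ : U))).1 ?_
    refine hs.continuousAt.congr (.of_forall fun y => ?_)
    exact congrArg (Tot.mk (G := 𝒜.Fam) y.1) (zeroExt_of_mem s y.2).symm
  · refine 𝒜.continuous_zero.continuousAt.congr ?_
    filter_upwards [U.isClosed.isOpen_compl.mem_nhds hx] with y hy
    exact congrArg (Tot.mk (G := 𝒜.Fam) y) (zeroExt_of_notMem s hy).symm

variable [IsTopologicalRing R]

/-- Restriction of global sections to a clopen set. -/
def restrict (U : Clopens X) : 𝒜.cprod ⟶ 𝒜.sectionsOn U :=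
  ObjectProperty.homMk (ModuleCat.ofHom
    { toFun := fun s => ⟨fun y => s.1 y, s.2.comp continuous_subtype_val⟩
      map_add' := fun _ _ => rfl
      map_smul' := fun _ _ => rfl })

/-- Extension by zero of sections over a clopen set. -/
noncomputable def extendZero (U : Clopens X) : 𝒜.sectionsOn U ⟶ 𝒜.cprod :=
  ObjectProperty.homMk (ModuleCat.ofHom
    ((𝒜.zeroExt U).restrict fun _ hs => 𝒜.continuous_zeroExt hs))

lemma restrict_evOn (U : Clopens X) (x : U) : 𝒜.restrict U ≫ 𝒜.evOn U x = 𝒜.ev x := rfl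

lemma extendZero_ev_of_mem (U : Clopens X) (x : U) :
    𝒜.extendZero U ≫ 𝒜.ev x = 𝒜.evOn U x := by
  ext s
  exact zeroExt_of_mem s.1 x.2

lemma extendZero_ev_of_notMem {U : Clopens X} {x : X} (hx : x ∉ U) :
    𝒜.extendZero U ≫ 𝒜.ev x = 0 := by
  ext s
  exact zeroExt_of_notMem s.1 hx

variable {𝒜} in
lemma hom_cprod_ext {A : DMod R} {f g : A ⟶ 𝒜.cprod} (h : ∀ x, f ≫ 𝒜.ev x = g ≫ 𝒜.ev x) :
    f = g := by
  ext a
  exact Subtype.ext (funext fun x =>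
    congrArg (fun k : A ⟶ 𝒜.fib x => k.hom.hom a) (h x))

variable {𝒜} in
lemma hom_sectionsOn_ext {A : DMod R} {U : Clopens X} {f g : A ⟶ 𝒜.sectionsOn U}
    (h : ∀ x, f ≫ 𝒜.evOn U x = g ≫ 𝒜.evOn U x) : f = g := by
  ext a
  exact Subtype.ext (funext fun x =>
    congrArg (fun k : A ⟶ 𝒜.fib x => k.hom.hom a) (h x))

/-- The endomorphism of the module of global sections that sets a section to zero outside of a
clopen set. -/
noncomputable def cut (U : Clopens X) : 𝒜.cprod ⟶ 𝒜.cprod := 𝒜.restrict U ≫ 𝒜.extendZero U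

lemma cut_ev_of_mem {U : Clopens X} {x : X} (hx : x ∈ U) : 𝒜.cut U ≫ 𝒜.ev x = 𝒜.ev x := by
  rw [cut, Category.assoc, 𝒜.extendZero_ev_of_mem U ⟨x, hx⟩, restrict_evOn]

lemma cut_ev_of_notMem {U : Clopens X} {x : X} (hx : x ∉ U) : 𝒜.cut U ≫ 𝒜.ev x = 0 := by
  rw [cut, Category.assoc, 𝒜.extendZero_ev_of_notMem hx, comp_zero]

lemma cut_top : 𝒜.cut ⊤ = 𝟙 _ :=
  hom_cprod_ext fun x => (𝒜.cut_ev_of_mem (Set.mem_univ x)).trans (Category.id_comp _).symm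

lemma cut_sup {U V : Clopens X} (h : Disjoint U V) : 𝒜.cut (U ⊔ V) = 𝒜.cut U + 𝒜.cut V := by
  refine hom_cprod_ext fun x => ?_
  rw [Preadditive.add_comp]
  by_cases hU : x ∈ U
  · have hV : x ∉ V := fun hV => h.le_bot (show x ∈ U ⊓ V from ⟨hU, hV⟩)
    rw [𝒜.cut_ev_of_mem hU, 𝒜.cut_ev_of_notMem hV, 𝒜.cut_ev_of_mem (Or.inl hU), add_zero]
  · rw [𝒜.cut_ev_of_notMem hU, zero_add]
    by_cases hV : x ∈ V
    · rw [𝒜.cut_ev_of_mem hV, 𝒜.cut_ev_of_mem (Or.inr hV)]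
    · rw [𝒜.cut_ev_of_notMem hV, 𝒜.cut_ev_of_notMem (not_or_intro hU hV)]

lemma cut_cut {U V : Clopens X} (h : U ≤ V) : 𝒜.cut V ≫ 𝒜.cut U = 𝒜.cut U := by
  refine hom_cprod_ext fun x => ?_
  rw [Category.assoc]
  by_cases hU : x ∈ U
  · rw [𝒜.cut_ev_of_mem hU, 𝒜.cut_ev_of_mem (h hU)]
  · rw [𝒜.cut_ev_of_notMem hU, comp_zero]

/-- The map from sections over `U` to sections over `V` that is restriction on `U ⊓ V` and zero
elsewhere. It is defined for all `U` and `V` but of interest only for `V ≤ U`. -/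
noncomputable def transition (U V : Clopens X) : 𝒜.sectionsOn U ⟶ 𝒜.sectionsOn V :=
  𝒜.extendZero U ≫ 𝒜.restrict V

lemma transition_evOn {U V : Clopens X} (h : V ≤ U) (x : V) :
    𝒜.transition U V ≫ 𝒜.evOn V x = 𝒜.evOn U ⟨x, h x.2⟩ := by
  rw [transition, Category.assoc, restrict_evOn]
  exact 𝒜.extendZero_ev_of_mem U ⟨x, h x.2⟩

lemma transition_self (U : Clopens X) : 𝒜.transition U U = 𝟙 _ :=
  hom_sectionsOn_ext fun x => (𝒜.transition_evOn le_rfl x).trans (Category.id_comp _).symm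

lemma transition_transition {U V W : Clopens X} (hVU : V ≤ U) (hWV : W ≤ V) :
    𝒜.transition U V ≫ 𝒜.transition V W = 𝒜.transition U W := by
  refine hom_sectionsOn_ext fun y => ?_
  rw [Category.assoc, 𝒜.transition_evOn hWV, 𝒜.transition_evOn hVU,
    𝒜.transition_evOn (hWV.trans hVU)]

lemma restrict_top_transition (U : Clopens X) :
    𝒜.restrict ⊤ ≫ 𝒜.transition ⊤ U = 𝒜.restrict U := by
  rw [transition, ← Category.assoc, ← cut, cut_top, Category.id_comp]

/-- The clopen neighbourhoods of a point, ordered by reverse inclusion. -/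
abbrev ClopenNhds (x : X) : Type u := {U : Clopens X // x ∈ U}ᵒᵈ

instance (x : X) : Nonempty (ClopenNhds x) := ⟨OrderDual.toDual ⟨⊤, trivial⟩⟩

instance (x : X) : IsDirectedOrder (ClopenNhds x) :=
  ⟨fun U V => ⟨OrderDual.toDual ⟨U.ofDual.1 ⊓ V.ofDual.1, U.ofDual.2, V.ofDual.2⟩,
    fun _ h => h.1, fun _ h => h.2⟩⟩

/-- The modules of sections over the clopen neighbourhoods of a point. -/
noncomputable def sectionsFunctor (x : X) : ClopenNhds x ⥤ DMod R where
  obj U := 𝒜.sectionsOn U.ofDual.1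
  map {U V} _ := 𝒜.transition U.ofDual.1 V.ofDual.1
  map_id U := 𝒜.transition_self U.ofDual.1
  map_comp f g := (𝒜.transition_transition (leOfHom f) (leOfHom g)).symm

/-- The evaluations at a point of sections over its clopen neighbourhoods. -/
noncomputable def stalkCocone (x : X) : Cocone (𝒜.sectionsFunctor x) where
  pt := 𝒜.fib x
  ι :=
    { app := fun U => 𝒜.evOn U.ofDual.1 ⟨x, U.ofDual.2⟩
      naturality := fun U V f =>
        (𝒜.transition_evOn (leOfHom f : V.ofDual.1 ≤ U.ofDual.1) ⟨x, V.ofDual.2⟩).trans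
          (Category.comp_id _).symm }

lemma isElemColim_stalkCocone (x : X) : IsElemColim (𝒜.stalkCocone x) (toAb R) where
  exists_rep a := by
    obtain ⟨s, hsx, hs⟩ := 𝒜.exists_local_section x a
    obtain ⟨U, hxU, hU⟩ := exists_clopens_of_eventually hs
    have hc : Continuous fun y : U => (⟨y, s y⟩ : Tot 𝒜.Fam) :=
      continuous_iff_continuousAt.2 fun y =>
        ContinuousAt.comp (f := ((↑) : U → X)) (g := fun y => (⟨y, s y⟩ : Tot 𝒜.Fam))
          (hU y y.2) continuous_subtype_val.continuousAt
    exact ⟨OrderDual.toDual ⟨U, hxU⟩, ⟨fun y => s y, hc⟩, hsx⟩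
  exists_map_eq_zero U m hm := by
    let s : ∀ y, 𝒜.Fam y := 𝒜.zeroExt U.ofDual.1 m.1
    have hs : Continuous fun y => (⟨y, s y⟩ : Tot 𝒜.Fam) := 𝒜.continuous_zeroExt m.2
    have hsx : s x = 0 := (zeroExt_of_mem m.1 U.ofDual.2).trans hm
    obtain ⟨W, hxW, hW⟩ := exists_clopens_of_eventually
      (eventually_eq_of_eq hs.continuousAt 𝒜.continuous_zero.continuousAt hsx)
    exact ⟨OrderDual.toDual ⟨W ⊓ U.ofDual.1, hxW, U.ofDual.2⟩, homOfLE fun _ h => h.2,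
      Subtype.ext (funext fun y => hW y y.2.1)⟩

end EtaleMod

end EtaleStalks

section ExtEtaleSpace

open TopologicalSpace Topology

variable {R : Type u} [Ring R] [TopologicalSpace R] [IsTopologicalRing R]
  {X Y : Profinite.{u}}

namespace EtaleMod

lemma Hom.extPost_ev_extPost_cprodMap {f : C(Y, X)} {𝒜 : EtaleMod R X} {ℬ : EtaleMod R Y}
    (φ : Hom f 𝒜 ℬ) (Z : PMod R) (n : ℕ) (y : Y) (a : ExtR Z 𝒜.cprod n) :
    extPost Z (ℬ.ev y) n (extPost Z φ.cprodMap n a) =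
      extPost Z (φ.app y) n (extPost Z (𝒜.ev (f y)) n a) := by
  rw [extPost_extPost, extPost_extPost]
  rfl

variable [CompactSpace R] [T2Space R] [TotallyDisconnectedSpace R] (Z : PMod R)
  (𝒜 : EtaleMod R X) (n : ℕ)

lemma exists_extPost_evOn_eq {x : X} (g : ExtR Z (𝒜.fib x) n) :
    ∃ (U : Clopens X) (hx : x ∈ U) (m : ExtR Z (𝒜.sectionsOn U) n),
      extPost Z (𝒜.evOn U ⟨x, hx⟩) n m = g := by
  obtain ⟨U, m, hm⟩ := ((𝒜.isElemColim_stalkCocone x).comp_extFunctor Z n).exists_rep g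
  exact ⟨U.ofDual.1, U.ofDual.2, m, hm⟩

lemma exists_extPost_transition_eq_zero {x : X} {U : Clopens X} (hx : x ∈ U)
    {m : ExtR Z (𝒜.sectionsOn U) n} (hm : extPost Z (𝒜.evOn U ⟨x, hx⟩) n m = 0) :
    ∃ V : Clopens X, x ∈ V ∧ extPost Z (𝒜.transition U V) n m = 0 := by
  obtain ⟨V, _, hV⟩ := ((𝒜.isElemColim_stalkCocone x).comp_extFunctor Z n).exists_map_eq_zero
    (OrderDual.toDual ⟨U, hx⟩) m hm
  exact ⟨V.ofDual.1, V.ofDual.2, hV⟩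

lemma extPost_ev_surjective (x : X) : Function.Surjective (extPost Z (𝒜.ev x) n) := fun g => by
  obtain ⟨U, hx, m, rfl⟩ := 𝒜.exists_extPost_evOn_eq Z n g
  refine ⟨extPost Z (𝒜.extendZero U) n m, ?_⟩
  rw [extPost_extPost, 𝒜.extendZero_ev_of_mem U ⟨x, hx⟩]

lemma exists_extPost_cut_eq_zero {x : X} {a : ExtR Z 𝒜.cprod n}
    (ha : extPost Z (𝒜.ev x) n a = 0) :
    ∃ U : Clopens X, x ∈ U ∧ extPost Z (𝒜.cut U) n a = 0 := by
  obtain ⟨U, hU, h0⟩ := 𝒜.exists_extPost_transition_eq_zero Z n (U := ⊤) (Set.mem_univ x)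
    (m := extPost Z (𝒜.restrict ⊤) n a) (by rwa [extPost_extPost, restrict_evOn])
  rw [extPost_extPost, restrict_top_transition] at h0
  exact ⟨U, hU, by rw [cut, ← extPost_extPost, h0, map_zero]⟩

/-- The groups `Ext_R^n(Z, A_x)` as the stalks of `Ext_R^n(Z, ∏ 𝒜)`. -/
noncomputable def extGermData : GermData X (ExtFam Z 𝒜 n) (ExtR Z 𝒜.cprod n) where
  ev x := extPost Z (𝒜.ev x) n
  proj U := extPost Z (𝒜.cut U) n
  ev_surjective := 𝒜.extPost_ev_surjective Z n
  exists_proj_eq_zero _ _ := 𝒜.exists_extPost_cut_eq_zero Z n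
  ev_proj_of_mem x U a hx := by rw [extPost_extPost, 𝒜.cut_ev_of_mem hx]
  ev_proj_of_notMem x U a hx := by
    rw [extPost_extPost, 𝒜.cut_ev_of_notMem hx, extPost_zero, AddMonoidHom.zero_apply]
  proj_top a := by rw [cut_top, extPost_id, AddMonoidHom.id_apply]
  proj_sup U V a h := by rw [𝒜.cut_sup h, extPost_add, AddMonoidHom.add_apply]
  proj_proj_of_le U V a h := by rw [extPost_extPost, 𝒜.cut_cut h]

lemma range_extPost_evOn_eq_germs {U : Clopens X} {s : ExtR Z (𝒜.sectionsOn U) n}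
    {a : ExtR Z 𝒜.cprod n}
    (h : ∀ x : U, extPost Z (𝒜.evOn U x) n s = extPost Z (𝒜.ev x) n a) :
    Set.range (fun x : U => (⟨x, extPost Z (𝒜.evOn U x) n s⟩ : Tot (ExtFam Z 𝒜 n))) =
      (𝒜.extGermData Z n).germs U a := by
  ext ⟨x, g⟩
  constructor
  · rintro ⟨y, hy⟩
    rw [← hy]
    exact ⟨y.2, h y⟩
  · rintro ⟨hx, hg⟩
    exact ⟨⟨x, hx⟩, congrArg (Tot.mk (G := ExtFam Z 𝒜 n) x) ((h ⟨x, hx⟩).trans hg.symm)⟩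

lemma extTop_eq : extTop Z 𝒜 n = (𝒜.extGermData Z n).top := by
  refine congrArg TopologicalSpace.generateFrom (Set.ext fun O => ?_)
  constructor
  · rintro ⟨U, s, rfl⟩
    exact ⟨U, extPost Z (𝒜.extendZero U) n s, 𝒜.range_extPost_evOn_eq_germs Z n fun x => by
      rw [extPost_extPost, extendZero_ev_of_mem]⟩
  · rintro ⟨U, a, rfl⟩
    exact ⟨U, extPost Z (𝒜.restrict U) n a, (𝒜.range_extPost_evOn_eq_germs Z n fun x => by
      rw [extPost_extPost, restrict_evOn]).symm⟩

lemma isEtaleTorsion_extTop : IsEtaleTorsion (ExtFam Z 𝒜 n) (extTop Z 𝒜 n) := by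
  rw [extTop_eq]
  exact (𝒜.extGermData Z n).isEtaleTorsion fun x => isAddTorsion_extR Z (𝒜.fib x) n

/-- The isomorphism `Ext_R^n(Z, ∏ 𝒜) ≃ ∏ Ext_R^n(Z, A_x)`. -/
noncomputable def extCprodEquiv : ExtR Z 𝒜.cprod n ≃+ (𝒜.isEtaleTorsion_extTop Z n).cprod :=
  (𝒜.extGermData Z n).cprodEquiv (𝒜.extTop_eq Z n) _

lemma extCprodEquiv_apply (a : ExtR Z 𝒜.cprod n) (x : X) :
    (𝒜.extCprodEquiv Z n a).1 x = extPost Z (𝒜.ev x) n a := rfl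

variable {𝒜} {ℬ : EtaleMod R Y} {f : C(Y, X)} (φ : Hom f 𝒜 ℬ)

lemma Hom.continuous_extPost : Continuous[pullTop f (ExtFam Z 𝒜 n) (extTop Z 𝒜 n), extTop Z ℬ n]
    (fun t => (⟨t.base, extPost Z (φ.app t.base) n t.val⟩ : Tot (ExtFam Z ℬ n))) := by
  rw [extTop_eq, extTop_eq]
  let _ := (𝒜.extGermData Z n).top
  let _ := pullTop f (ExtFam Z 𝒜 n) (𝒜.extGermData Z n).top
  let _ := (ℬ.extGermData Z n).top
  refine continuous_iff_continuousAt.2 fun t => ?_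
  obtain ⟨a, ha⟩ := 𝒜.extPost_ev_surjective Z n (f t.base) t.val
  have hfst := continuous_pullTop_fst f (ExtFam Z 𝒜 n) (𝒜.extGermData Z n).top
  refine (ℬ.extGermData Z n).continuousAt_of_eventually
    (continuous_pullTop_base f _ _).continuousAt (extPost Z φ.cprodMap n a) ?_
  filter_upwards [(𝒜.extGermData Z n).eventually_val_eq hfst.continuousAt ha] with s hs
  exact (congrArg (extPost Z (φ.app s.base) n) hs).trans
    (φ.extPost_ev_extPost_cprodMap Z n s.base a).symm

lemma Hom.extCprodEquiv_extPost (a : ExtR Z 𝒜.cprod n) (y : Y) :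
    (ℬ.extCprodEquiv Z n (extPost Z φ.cprodMap n a)).1 y =
      extPost Z (φ.app y) n ((𝒜.extCprodEquiv Z n a).1 (f y)) :=
  φ.extPost_ev_extPost_cprodMap Z n y a

end EtaleMod

end ExtEtaleSpace

section Transport

universe w v₁ u₁

lemma exact_conj_addEquiv {A B D A' B' D' : Type*} [AddCommGroup A] [AddCommGroup B]
    [AddCommGroup D] [AddCommGroup A'] [AddCommGroup B'] [AddCommGroup D'] {f : A →+ B}
    {g : B →+ D} (h : Function.Exact f g) (a : A ≃+ A') (b : B ≃+ B') (d : D ≃+ D') :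
    Function.Exact ((b.toAddMonoidHom.comp f).comp a.symm.toAddMonoidHom)
      ((d.toAddMonoidHom.comp g).comp b.symm.toAddMonoidHom) := by
  refine (Function.Exact.iff_of_ladder_addEquiv a b d ?_ ?_).2 h
  · ext x
    exact congrArg (b <| f ·) (a.symm_apply_apply x)
  · ext y
    exact congrArg (d <| g ·) (b.symm_apply_apply y)

namespace CohomologicalDeltaFunctor

variable {C : Type u₁} [Category.{v₁} C]
    {exactSeq : ∀ {A B D : C}, (A ⟶ B) → (B ⟶ D) → Prop}
    {T T' : ℕ → C → Type w} [∀ n A, AddCommGroup (T n A)] [∀ n A, AddCommGroup (T' n A)]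
    (L : CohomologicalDeltaFunctor C exactSeq T) (e : ∀ n A, T n A ≃+ T' n A)

/-- Transport of a δ-functor along isomorphisms of groups. -/
def transport : CohomologicalDeltaFunctor C exactSeq T' where
  map n {A B} f := ((e n B).toAddMonoidHom.comp (L.map n f)).comp (e n A).symm.toAddMonoidHom
  map_id n A := by
    ext t
    rw [L.map_id]
    exact (e n A).apply_symm_apply t
  map_comp n {A B D} f g := by
    ext t
    rw [L.map_comp]
    exact congrArg (e n D <| L.map n g ·) ((e n B).symm_apply_apply _).symm
  δ n {A B D} f g h :=
    ((e (n + 1) A).toAddMonoidHom.comp (L.δ n f g h)).comp (e n D).symm.toAddMonoidHom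
  δ_naturality n {A B D A' B' D'} f g h f' g' h' a b d hab hbd := by
    ext t
    have hnat := DFunLike.congr_fun (L.δ_naturality n f g h f' g' h' a b d hab hbd)
      ((e n D).symm t)
    exact (congrArg (e (n + 1) A' <| L.map (n + 1) a ·)
      ((e (n + 1) A).symm_apply_apply _)).trans ((congrArg (e (n + 1) A') hnat).trans
      (congrArg (e (n + 1) A' <| L.δ n f' g' h' ·) ((e n D').symm_apply_apply _).symm))
  injective_zero {A B D} f g h :=
    (e 0 B).injective.comp ((L.injective_zero f g h).comp (e 0 A).symm.injective)
  exact_middle n {A B D} f g h :=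
    exact_conj_addEquiv (L.exact_middle n f g h) (e n A) (e n B) (e n D)
  exact_right n {A B D} f g h :=
    exact_conj_addEquiv (L.exact_right n f g h) (e n B) (e n D) (e (n + 1) A)
  exact_left n {A B D} f g h :=
    exact_conj_addEquiv (L.exact_left n f g h) (e n D) (e (n + 1) A) (e (n + 1) B)

lemma transport_map_apply (n : ℕ) {A B : C} (f : A ⟶ B) (t : T n A) :
    (L.transport e).map n f (e n A t) = e n B (L.map n f t) :=
  congrArg (e n B <| L.map n f ·) ((e n A).symm_apply_apply t)

lemma transport_δ_apply (n : ℕ) {A B D : C} (f : A ⟶ B) (g : B ⟶ D) (h : exactSeq f g)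
    (t : T n D) : (L.transport e).δ n f g h (e n D t) = e (n + 1) A (L.δ n f g h t) :=
  congrArg (e (n + 1) A <| L.δ n f g h ·) ((e n D).symm_apply_apply t)

/-- The isomorphism of a δ-functor with its transport. -/
def isoTransport : L.Iso (L.transport e) where
  equiv := e
  map_comm n _ _ f t := (L.transport_map_apply e n f t).symm
  δ_comm n _ _ _ f g h t := (L.transport_δ_apply e n f g h t).symm

end CohomologicalDeltaFunctor

end Transport

section DeltaFunctors

variable {R : Type u} [Ring R] [TopologicalSpace R] [IsTopologicalRing R]
  {X : Profinite.{u}}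

namespace EtaleMod.IsShortExact

variable {A B D A' B' D' : EtaleMod R X} {f : A ⟶ B} {g : B ⟶ D} {f' : A' ⟶ B'} {g' : B' ⟶ D'}

/-- The map of the sequences of global sections induced by a map of short exact sequences of étale
spaces. -/
def cprodSeqMap (h : IsShortExact f g) (h' : IsShortExact f' g') (a : A ⟶ A') (b : B ⟶ B')
    (d : D ⟶ D') (hab : f ≫ b = a ≫ f') (hbd : g ≫ d = b ≫ g') : h.cprodSeq ⟶ h'.cprodSeq where
  τ₁ := Hom.cprodMap a
  τ₂ := Hom.cprodMap b
  τ₃ := Hom.cprodMap d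
  comm₁₂ := (congrArg Hom.cprodMap hab).symm
  comm₂₃ := (congrArg Hom.cprodMap hbd).symm

/-- Evaluation at a point as a map from the sequence of global sections to the sequence of
fibres. -/
def evSeq (h : IsShortExact f g) (x : X) : h.cprodSeq ⟶ h.fibSeq x where
  τ₁ := A.ev x
  τ₂ := B.ev x
  τ₃ := D.ev x
  comm₁₂ := rfl
  comm₂₃ := rfl

lemma extPost_cprodMap_zero_injective (Z : PMod R) (h : IsShortExact f g) :
    Function.Injective (extPost Z (Hom.cprodMap f) 0) := by
  have hinj := extPost_zero_injective Z h.cprodSeq_shortExact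
  exact hinj

end EtaleMod.IsShortExact

/-- The δ-functor `Ext_R^n(Z, ∏ 𝒜)` in the étale space `𝒜`. -/
noncomputable def extCprodDelta (X : Profinite.{u}) (Z : PMod R) :
    CohomologicalDeltaFunctor (EtaleMod R X) EtaleMod.IsShortExact
      (fun n 𝒜 => ExtR Z 𝒜.cprod n) where
  map n {_ _} φ := extPost Z (EtaleMod.Hom.cprodMap φ) n
  map_id n 𝒜 := extPost_id Z 𝒜.cprod n
  map_comp n {_ _ _} f g := extPost_comp Z (EtaleMod.Hom.cprodMap f) (EtaleMod.Hom.cprodMap g) n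
  δ n {_ _ _} _ _ h := extDelta Z h.cprodSeq_shortExact n
  δ_naturality n {_ _ _ _ _ _} _ _ h _ _ h' a b d hab hbd :=
    AddMonoidHom.ext fun t => extPost_extDelta Z h.cprodSeq_shortExact h'.cprodSeq_shortExact
      (h.cprodSeqMap h' a b d hab hbd) n t
  injective_zero {_ _ _} _ _ h := h.extPost_cprodMap_zero_injective Z
  exact_middle n {_ _ _} _ _ h := extPost_exact Z h.cprodSeq_shortExact n
  exact_right n {_ _ _} _ _ h := extPost_extDelta_exact Z h.cprodSeq_shortExact n
  exact_left n {_ _ _} _ _ h := extDelta_extPost_exact Z h.cprodSeq_shortExact n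

section Compact

variable [CompactSpace R]

/-- The contravariant δ-functor `Ext_R^n(Z, A)` in the profinite module `Z`. -/
noncomputable def extPreDelta (A : DMod R) :
    CohomologicalDeltaFunctor (PMod R)ᵒᵖ (fun f g => PMod.IsShortExact g.unop f.unop)
      (fun n Z => ExtR Z.unop A n) where
  map n _ _ f := extPre f.unop A n
  map_id n Z := extPre_id Z.unop A n
  map_comp n _ _ _ f g := extPre_comp g.unop f.unop A n
  δ n _ _ _ _ _ h := extDeltaPre h A n
  δ_naturality n _ _ _ _ _ _ _ _ h _ _ h' a b d hab hbd :=
    AddMonoidHom.ext fun t => extPre_extDeltaPre h h' a.unop b.unop d.unop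
      (congrArg Quiver.Hom.unop hbd).symm (congrArg Quiver.Hom.unop hab).symm A n t
  injective_zero _ _ h := extPre_zero_injective h A
  exact_middle n _ _ _ _ _ h := extPre_exact h A n
  exact_right n _ _ _ _ _ h := extPre_extDeltaPre_exact h A n
  exact_left n _ _ _ _ _ h := extDeltaPre_extPre_exact h A n

variable [T2Space R] [TotallyDisconnectedSpace R]

/-- The δ-functor `∏ Ext_R^n(Z, A_x)` in the étale space `𝒜`. -/
noncomputable def cprodExtDelta (X : Profinite.{u}) (Z : PMod R) :
    CohomologicalDeltaFunctor (EtaleMod R X) EtaleMod.IsShortExact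
      (fun n 𝒜 => (𝒜.isEtaleTorsion_extTop Z n).cprod) :=
  (extCprodDelta X Z).transport fun n 𝒜 => 𝒜.extCprodEquiv Z n

lemma cprodExtDelta_map_apply (Z : PMod R) (n : ℕ) {𝒜 ℬ : EtaleMod R X} (φ : 𝒜 ⟶ ℬ)
    (s : (𝒜.isEtaleTorsion_extTop Z n).cprod) (x : X) :
    ((cprodExtDelta X Z).map n φ s).1 x = extPost Z (EtaleMod.Hom.app φ x) n (s.1 x) := by
  obtain ⟨a, rfl⟩ := (𝒜.extCprodEquiv Z n).surjective s
  exact (congrArg (fun t => t.1 x) ((extCprodDelta X Z).transport_map_apply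
    (fun n 𝒜 => 𝒜.extCprodEquiv Z n) n φ a)).trans
    (EtaleMod.Hom.extCprodEquiv_extPost Z n φ a x)

lemma cprodExtDelta_δ_apply (Z : PMod R) (n : ℕ) {𝒜' 𝒜 𝒜'' : EtaleMod R X} {φ : 𝒜' ⟶ 𝒜}
    {ψ : 𝒜 ⟶ 𝒜''} (h : EtaleMod.IsShortExact φ ψ) (s : (𝒜''.isEtaleTorsion_extTop Z n).cprod)
    (x : X) :
    ((cprodExtDelta X Z).δ n φ ψ h s).1 x = extDelta Z (h.fibSeq_shortExact x) n (s.1 x) := by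
  obtain ⟨a, rfl⟩ := (𝒜''.extCprodEquiv Z n).surjective s
  exact (congrArg (fun t => t.1 x) ((extCprodDelta X Z).transport_δ_apply
    (fun n 𝒜 => 𝒜.extCprodEquiv Z n) n φ ψ h a)).trans
    (extPost_extDelta Z h.cprodSeq_shortExact (h.fibSeq_shortExact x) (h.evSeq x) n a)

/-- The contravariant δ-functor `∏ Ext_R^n(Z, A_x)` in the profinite module `Z`. -/
noncomputable def cprodExtPreDelta (𝒜 : EtaleMod R X) :
    CohomologicalDeltaFunctor (PMod R)ᵒᵖ (fun f g => PMod.IsShortExact g.unop f.unop)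
      (fun n Z => (𝒜.isEtaleTorsion_extTop Z.unop n).cprod) :=
  (extPreDelta 𝒜.cprod).transport fun n Z => 𝒜.extCprodEquiv Z.unop n

lemma cprodExtPreDelta_map_apply (𝒜 : EtaleMod R X) (n : ℕ) {Z Z' : PMod R} (ζ : Z' ⟶ Z)
    (s : (𝒜.isEtaleTorsion_extTop Z n).cprod) (x : X) :
    ((cprodExtPreDelta 𝒜).map n ζ.op s).1 x = extPre ζ (𝒜.fib x) n (s.1 x) := by
  obtain ⟨a, rfl⟩ := (𝒜.extCprodEquiv Z n).surjective s
  exact (congrArg (fun t => t.1 x) ((extPreDelta 𝒜.cprod).transport_map_apply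
    (fun n Z => 𝒜.extCprodEquiv Z.unop n) n ζ.op a)).trans (extPost_extPre ζ (𝒜.ev x) n a)

lemma cprodExtPreDelta_δ_apply (𝒜 : EtaleMod R X) (n : ℕ) {Z' Z Z'' : PMod R} {i : Z' ⟶ Z}
    {q : Z ⟶ Z''} (h : PMod.IsShortExact i q) (s : (𝒜.isEtaleTorsion_extTop Z' n).cprod) (x : X) :
    ((cprodExtPreDelta 𝒜).δ n q.op i.op h s).1 x = extDeltaPre h (𝒜.fib x) n (s.1 x) := by
  obtain ⟨a, rfl⟩ := (𝒜.extCprodEquiv Z' n).surjective s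
  exact (congrArg (fun t => t.1 x) ((extPreDelta 𝒜.cprod).transport_δ_apply
    (fun n Z => 𝒜.extCprodEquiv Z.unop n) n q.op i.op h a)).trans
    (extPost_extDeltaPre h (𝒜.ev x) n a)

end Compact

end DeltaFunctors

theorem mainTheorem7 {R : Type u} [Ring R] [TopologicalSpace R] [IsTopologicalRing R]
    [CompactSpace R] [T2Space R] [TotallyDisconnectedSpace R] :
    ∃ hE : ∀ (X : Profinite.{u}) (Z : PMod R) (𝒜 : EtaleMod R X) (n : ℕ),
        IsEtaleTorsion (ExtFam Z 𝒜 n) (extTop Z 𝒜 n),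
    ∃ Φ : ∀ (X : Profinite.{u}) (Z : PMod R) (𝒜 : EtaleMod R X) (n : ℕ),
        ExtR Z 𝒜.cprod n ≃+ (hE X Z 𝒜 n).cprod,
      (∀ (X : Profinite.{u}) (Z : PMod R) (𝒜 : EtaleMod R X) (n : ℕ)
        (a : ExtR Z 𝒜.cprod n) (x : X), (Φ X Z 𝒜 n a).1 x = extPost Z (𝒜.ev x) n a) ∧
      (∀ (X Y : Profinite.{u}) (f : C(Y, X)) (Z : PMod R) (𝒜 : EtaleMod R X) (ℬ : EtaleMod R Y)
        (φ : EtaleMod.Hom f 𝒜 ℬ) (n : ℕ),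
        Continuous[pullTop f (ExtFam Z 𝒜 n) (extTop Z 𝒜 n), extTop Z ℬ n]
          (fun t => ⟨t.base, extPost Z (φ.app t.base) n t.val⟩) ∧
        ∀ (a : ExtR Z 𝒜.cprod n) (y : Y),
          (Φ Y Z ℬ n (extPost Z φ.cprodMap n a)).1 y =
            extPost Z (φ.app y) n ((Φ X Z 𝒜 n a).1 (f y))) ∧
      (∀ (X : Profinite.{u}) (Z : PMod R),
        ∃ (L : CohomologicalDeltaFunctor (EtaleMod R X) EtaleMod.IsShortExact
              (fun n 𝒜 => ExtR Z 𝒜.cprod n))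
          (P : CohomologicalDeltaFunctor (EtaleMod R X) EtaleMod.IsShortExact
              (fun n 𝒜 => (hE X Z 𝒜 n).cprod))
          (e : L.Iso P),
          (∀ n (𝒜 ℬ : EtaleMod R X) (φ : 𝒜 ⟶ ℬ),
            L.map n φ = extPost Z (EtaleMod.Hom.cprodMap φ) n) ∧
          (∀ n (𝒜' 𝒜 𝒜'' : EtaleMod R X) (φ : 𝒜' ⟶ 𝒜) (ψ : 𝒜 ⟶ 𝒜'')
            (h : EtaleMod.IsShortExact φ ψ),
            L.δ n φ ψ h = extDelta Z h.cprodSeq_shortExact n) ∧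
          (∀ n (𝒜 ℬ : EtaleMod R X) (φ : 𝒜 ⟶ ℬ) (s : (hE X Z 𝒜 n).cprod) (x : X),
            (P.map n φ s).1 x = extPost Z (EtaleMod.Hom.app φ x) n (s.1 x)) ∧
          (∀ n (𝒜' 𝒜 𝒜'' : EtaleMod R X) (φ : 𝒜' ⟶ 𝒜) (ψ : 𝒜 ⟶ 𝒜'')
            (h : EtaleMod.IsShortExact φ ψ) (s : (hE X Z 𝒜'' n).cprod) (x : X),
            (P.δ n φ ψ h s).1 x = extDelta Z (h.fibSeq_shortExact x) n (s.1 x)) ∧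
          ∀ n 𝒜, e.equiv n 𝒜 = Φ X Z 𝒜 n) ∧
      (∀ (X : Profinite.{u}) (𝒜 : EtaleMod R X),
        ∃ (L : CohomologicalDeltaFunctor (PMod R)ᵒᵖ (fun f g => PMod.IsShortExact g.unop f.unop)
              (fun n Z => ExtR Z.unop 𝒜.cprod n))
          (P : CohomologicalDeltaFunctor (PMod R)ᵒᵖ (fun f g => PMod.IsShortExact g.unop f.unop)
              (fun n Z => (hE X Z.unop 𝒜 n).cprod))
          (e : L.Iso P),
          (∀ n (Z Z' : PMod R) (ζ : Z' ⟶ Z), L.map n ζ.op = extPre ζ 𝒜.cprod n) ∧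
          (∀ n (Z' Z Z'' : PMod R) (i : Z' ⟶ Z) (q : Z ⟶ Z'') (h : PMod.IsShortExact i q),
            L.δ n q.op i.op h = extDeltaPre h 𝒜.cprod n) ∧
          (∀ n (Z Z' : PMod R) (ζ : Z' ⟶ Z) (s : (hE X Z 𝒜 n).cprod) (x : X),
            (P.map n ζ.op s).1 x = extPre ζ (𝒜.fib x) n (s.1 x)) ∧
          (∀ n (Z' Z Z'' : PMod R) (i : Z' ⟶ Z) (q : Z ⟶ Z'') (h : PMod.IsShortExact i q)
            (s : (hE X Z' 𝒜 n).cprod) (x : X),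
            (P.δ n q.op i.op h s).1 x = extDeltaPre h (𝒜.fib x) n (s.1 x)) ∧
          ∀ n Z, e.equiv n Z = Φ X Z.unop 𝒜 n) := by
  refine ⟨fun X Z 𝒜 n => 𝒜.isEtaleTorsion_extTop Z n, fun X Z 𝒜 n => 𝒜.extCprodEquiv Z n,
    fun X Z 𝒜 n => 𝒜.extCprodEquiv_apply Z n,
    fun X Y f Z 𝒜 ℬ φ n => ⟨φ.continuous_extPost Z n, φ.extCprodEquiv_extPost Z n⟩,
    fun X Z => ?_, fun X 𝒜 => ?_⟩
  · exact ⟨extCprodDelta X Z, cprodExtDelta X Z, (extCprodDelta X Z).isoTransport _,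
      fun _ _ _ _ => rfl, fun _ _ _ _ _ _ _ => rfl,
      fun n _ _ φ s x => cprodExtDelta_map_apply Z n φ s x,
      fun n _ _ _ _ _ h s x => cprodExtDelta_δ_apply Z n h s x, fun _ _ => rfl⟩
  · exact ⟨extPreDelta 𝒜.cprod, cprodExtPreDelta 𝒜, (extPreDelta 𝒜.cprod).isoTransport _,
      fun _ _ _ _ => rfl, fun _ _ _ _ _ _ _ => rfl,
      fun n _ _ ζ s x => cprodExtPreDelta_map_apply 𝒜 n ζ s x,
      fun n _ _ _ _ _ h s x => cprodExtPreDelta_δ_apply 𝒜 n h s x, fun _ _ => rfl⟩
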